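/- Let $\mathcal G\rightrightarrows M$ be a Lie groupoid with source $s$ and target $t$. Let $\mathcal V\rightrightarrows E$ be a VB-groupoid over $\mathcal G$, with source $\tilde s$, target $\tilde t$, core $C=\ker(\tilde s:\mathcal V\to E)|_M$ and core-anchor $\partial=\tilde t|_C:C\to E$ (of possibly non-constant rank). Put $\mathfrak k=\operatorname{Ker}\partial$, $\mathfrak l=\operatorname{Coker}\partial$. Let $C^0_{VB}(\mathcal G,\mathcal V)=\Gamma(C)$ and, for $k\ge 1$, let $C^k_{VB}(\mathcal G,\mathcal V)$ be the space of smooth maps $c:\mathcal G^{(k)}\to\mathcal V$ with $c(g_1,\dots,g_k)\in\mathcal V_{g_1}$ for which $\tilde s(c(g_1,\dots,g_k))$ does not depend on $g_1$ (for $k=1$: depends only on $s(g_1)$). The differential is $(\delta\alpha)(g)=\alpha_{t(g)}\cdot 0_g+0_g\cdot(\alpha_{s(g)})^{-1}$ in degree $0$ and $$(\delta c)(g_1,\dots,g_{k+1})=-c(g_1g_2,g_3,\dots,g_{k+1})\cdot c(g_2,\dots,g_{k+1})^{-1}+\sum_{i=2}^{k}(-1)^i c(g_1,\dots,g_ig_{i+1},\dots,g_{k+1})+(-1)^{k+1}c(g_1,\dots,g_k)$$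 in degree $k\ge1$; its cohomology is $H^\bullet_{VB}(\mathcal G,\mathcal V)$. Let $C^k(\mathcal G,\mathfrak k)$ be the space of smooth sections of the pull-back of $C$ along $(g_1,\dots,g_k)\mapsto t(g_1)$ (of $C$ itself if $k=0$) with values in $\mathfrak k$, with the usual differential of groupoid cochains for the action $g\cdot v=0_g\cdot v\cdot 0_{g}^{-1}$ on $\mathfrak k$; its cohomology is $H^\bullet(\mathcal G,\mathfrak k)$. Let $\Gamma(\mathfrak l)=\Gamma(E)/\partial\Gamma(C)$ and let $\Gamma(\mathfrak l)^{inv}$ be the space of classes $[V]$ of sections $V\in\Gamma(E)$ having an $(\tilde s,\tilde t)$-lift, i.e. a smooth section $X$ of $\mathcal V\to\mathcal G$ with $\tilde s(X_g)=V_{s(g)}$ and $\tilde t(X_g)=V_{t(g)}$ for all $g$. Then there is an exact sequence of real vector spaces $$0\to H^1(\mathcal G,\mathfrak k)\xrightarrow{\,r\,}H^1_{VB}(\mathcal G,\mathcal V)\xrightarrow{\,\pi\,}\Gamma(\mathfrak l)^{inv}\xrightarrow{\,K\,}H^2(\mathcal G,\mathfrak k)\xrightarrow{\,r\,}H^2_{VB}(\mathcal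 G,\mathcal V),$$ where $r$ is induced by $r(c)(g_1,\dots,g_k)=c(g_1,\dots,g_k)\cdot0_{g_1}$, $\pi$ is induced by the $\tilde s$-projection of $1$-cochains to sections of $E$, and $K[V]$ is the class of the cocycle $e$ with $r(e)=\delta X$, for any $(\tilde s,\tilde t)$-lift $X$ of $V$. Likewise, let $(\Phi,\phi):(\mathcal H\rightrightarrows N)\to(\mathcal G\rightrightarrows M)$ be a morphism of Lie groupoids. Taking for the VB-groupoid over $\mathcal H$ the pull-back $\Phi^*T\mathcal G$ of the tangent groupoid of $\mathcal G$, whose VB-complex is the deformation complex of $\Phi$, one obtains the exact sequence $$0\to H^1(\mathcal H,\phi^*\mathfrak i_{\mathcal G})\to H^1_{def}(\Phi)\to\Gamma(\phi^*\nu_{\mathcal G})^{inv}\to H^2(\mathcal H,\phi^*\mathfrak i_{\mathcal G})\to H^2_{def}(\Phi),$$ with maps given by the same formulas, where $\mathfrak i_{\mathcal G}=\operatorname{Ker}(\rho:A_{\mathcal G}\to TM)$ is the isotropy bundle and $\nu_{\mathcal G}=\operatorname{Coker}(\rho)$ the normal bundle of $\mathcal G$ ($\rho$ the anchor of the Lie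 algebroid $A_{\mathcal G}$); here $\phi^*\mathfrak i_{\mathcal G}$ and $\phi^*\nu_{\mathcal G}$ are the $\mathfrak k$ and $\mathfrak l$ of $\Phi^*T\mathcal G$. -/

import Mathlib

open Bundle Manifold
open scoped ContDiff

noncomputable section

/-! ### Lie groupoids -/

/-- A Lie groupoid `G ⇉ M` (arrows `G`, objects `M`).  The multiplication is a total function, but
only its values on composable pairs (`src g = tgt h`) carry any information.  Since source and
target are submersions, the set of composable pairs is an embedded submanifold of `G × G`, on which
`ContMDiffOn` is smoothness for the submanifold structure. -/
structure LieGroupoid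
    {EG HG EM HM : Type*} [NormedAddCommGroup EG] [NormedSpace ℝ EG] [TopologicalSpace HG]
    [NormedAddCommGroup EM] [NormedSpace ℝ EM] [TopologicalSpace HM]
    (I : ModelWithCorners ℝ EG HG) (J : ModelWithCorners ℝ EM HM)
    (G M : Type*) [TopologicalSpace G] [ChartedSpace HG G]
    [TopologicalSpace M] [ChartedSpace HM M] where
  src : G → M
  tgt : G → M
  unit : M → G
  inv : G → G
  mul : G → G → G
  src_unit : ∀ x, src (unit x) = x
  tgt_unit : ∀ x, tgt (unit x) = x
  src_inv : ∀ g, src (inv g) = tgt g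
  tgt_inv : ∀ g, tgt (inv g) = src g
  src_mul : ∀ g h, src g = tgt h → src (mul g h) = src h
  tgt_mul : ∀ g h, src g = tgt h → tgt (mul g h) = tgt g
  mul_assoc : ∀ g h k, src g = tgt h → src h = tgt k → mul (mul g h) k = mul g (mul h k)
  unit_mul : ∀ g, mul (unit (tgt g)) g = g
  mul_unit : ∀ g, mul g (unit (src g)) = g
  inv_mul : ∀ g, mul (inv g) g = unit (src g)
  mul_inv : ∀ g, mul g (inv g) = unit (tgt g)
  smooth_src : ContMDiff I J ∞ src
  smooth_tgt : ContMDiff I J ∞ tgt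
  submersion_src : IsSubmersion I J ∞ src
  submersion_tgt : IsSubmersion I J ∞ tgt
  smooth_unit : ContMDiff J I ∞ unit
  smooth_inv : ContMDiff I I ∞ inv
  smooth_mul : ContMDiffOn (I.prod I) I ∞ (fun p : G × G => mul p.1 p.2)
    {p : G × G | src p.1 = tgt p.2}

namespace LieGroupoid

variable
    {EG HG EM HM : Type*} [NormedAddCommGroup EG] [NormedSpace ℝ EG] [TopologicalSpace HG]
    [NormedAddCommGroup EM] [NormedSpace ℝ EM] [TopologicalSpace HM]
    {I : ModelWithCorners ℝ EG HG} {J : ModelWithCorners ℝ EM HM}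
    {G M : Type*} [TopologicalSpace G] [ChartedSpace HG G]
    [TopologicalSpace M] [ChartedSpace HM M]
    (𝒢 : LieGroupoid I J G M)

/-- The set `G⁽²⁾` of composable pairs. -/
def Comp2 : Set (G × G) := {p | 𝒢.src p.1 = 𝒢.tgt p.2}

/-- The set `G⁽³⁾` of composable triples. -/
def Comp3 : Set (G × G × G) := {p | 𝒢.src p.1 = 𝒢.tgt p.2.1 ∧ 𝒢.src p.2.1 = 𝒢.tgt p.2.2}

theorem inv_unit (x : M) : 𝒢.inv (𝒢.unit x) = 𝒢.unit x := by
  have h1 := 𝒢.inv_mul (𝒢.unit x)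
  have h2 := 𝒢.mul_unit (𝒢.inv (𝒢.unit x))
  rw [𝒢.src_inv, 𝒢.tgt_unit] at h2
  rw [𝒢.src_unit] at h1
  exact h2.symm.trans h1

theorem mul_mul_inv {g h : G} (hc : 𝒢.src g = 𝒢.tgt h) :
    𝒢.mul (𝒢.mul g h) (𝒢.inv h) = g := by
  rw [𝒢.mul_assoc g h _ hc (𝒢.tgt_inv h).symm, 𝒢.mul_inv, ← hc, 𝒢.mul_unit]

theorem mul_inv_unit (g : G) : 𝒢.mul g (𝒢.inv (𝒢.unit (𝒢.src g))) = g := by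
  rw [𝒢.inv_unit, 𝒢.mul_unit]

theorem conj_unit (g : G) :
    𝒢.mul (𝒢.mul g (𝒢.unit (𝒢.src g))) (𝒢.inv g) = 𝒢.unit (𝒢.tgt g) := by
  rw [𝒢.mul_unit, 𝒢.mul_inv]

variable {𝒢}

/-- `(g₁g₂, g₃)` -/
abbrev face1 (p : 𝒢.Comp3) : 𝒢.Comp2 :=
  ⟨(𝒢.mul p.1.1 p.1.2.1, p.1.2.2), (𝒢.src_mul _ _ p.2.1).trans p.2.2⟩

/-- `(g₁, g₂g₃)` -/
abbrev face2 (p : 𝒢.Comp3) : 𝒢.Comp2 :=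
  ⟨(p.1.1, 𝒢.mul p.1.2.1 p.1.2.2), p.2.1.trans (𝒢.tgt_mul _ _ p.2.2).symm⟩

/-- `(g₁, g₂)` -/
abbrev face3 (p : 𝒢.Comp3) : 𝒢.Comp2 := ⟨(p.1.1, p.1.2.1), p.2.1⟩

/-- `(g₂, g₃)` -/
abbrev face0 (p : 𝒢.Comp3) : 𝒢.Comp2 := ⟨(p.1.2.1, p.1.2.2), p.2.2⟩

/-- A morphism of Lie groupoids `(Φ, φ) : (H ⇉ N) → (G ⇉ M)`. -/
structure Hom
    {EH HH EN HN : Type*} [NormedAddCommGroup EH] [NormedSpace ℝ EH] [TopologicalSpace HH]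
    [NormedAddCommGroup EN] [NormedSpace ℝ EN] [TopologicalSpace HN]
    {I' : ModelWithCorners ℝ EH HH} {J' : ModelWithCorners ℝ EN HN}
    {H N : Type*} [TopologicalSpace H] [ChartedSpace HH H]
    [TopologicalSpace N] [ChartedSpace HN N]
    (ℋ : LieGroupoid I' J' H N) (𝒢 : LieGroupoid I J G M) where
  toFun : H → G
  base : N → M
  smooth_toFun : ContMDiff I' I ∞ toFun
  smooth_base : ContMDiff J' J ∞ base
  map_src : ∀ h, 𝒢.src (toFun h) = base (ℋ.src h)
  map_tgt : ∀ h, 𝒢.tgt (toFun h) = base (ℋ.tgt h)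
  map_unit : ∀ y, toFun (ℋ.unit y) = 𝒢.unit (base y)
  map_mul : ∀ h k, ℋ.src h = ℋ.tgt k → toFun (ℋ.mul h k) = 𝒢.mul (toFun h) (toFun k)

theorem Hom.map_inv
    {EH HH EN HN : Type*} [NormedAddCommGroup EH] [NormedSpace ℝ EH] [TopologicalSpace HH]
    [NormedAddCommGroup EN] [NormedSpace ℝ EN] [TopologicalSpace HN]
    {I' : ModelWithCorners ℝ EH HH} {J' : ModelWithCorners ℝ EN HN}
    {H N : Type*} [TopologicalSpace H] [ChartedSpace HH H]
    [TopologicalSpace N] [ChartedSpace HN N]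
    {ℋ : LieGroupoid I' J' H N} (Φ : Hom ℋ 𝒢) (h : H) :
    𝒢.inv (Φ.toFun h) = Φ.toFun (ℋ.inv h) := by
  have e1 : 𝒢.mul (Φ.toFun (ℋ.inv h)) (Φ.toFun h) = 𝒢.unit (𝒢.src (Φ.toFun h)) := by
    rw [← Φ.map_mul _ _ (ℋ.src_inv h), ℋ.inv_mul, Φ.map_unit, Φ.map_src]
  have c1 : 𝒢.src (Φ.toFun (ℋ.inv h)) = 𝒢.tgt (Φ.toFun h) := by
    rw [Φ.map_src, Φ.map_tgt, ℋ.src_inv]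
  have e2 := 𝒢.mul_assoc _ _ _ c1 (𝒢.tgt_inv (Φ.toFun h)).symm
  have e3 := 𝒢.unit_mul (𝒢.inv (Φ.toFun h))
  have e4 := 𝒢.mul_unit (Φ.toFun (ℋ.inv h))
  rw [𝒢.tgt_inv] at e3
  rw [c1] at e4
  rw [e1, 𝒢.mul_inv, e3, e4] at e2
  exact e2

end LieGroupoid

/-- Identification of the fibres of a family of vector spaces over equal indices. -/
def fibCast {ι : Type*} (A : ι → Type*) [∀ i, AddCommGroup (A i)] [∀ i, Module ℝ (A i)]
    {i j : ι} (h : i = j) : A i →ₗ[ℝ] A j :=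
  (LinearEquiv.cast (R := ℝ) (M := A) h).toLinearMap

/-! ### Smooth sections along maps -/

section SmoothSections

variable
    {EP HP EQ HQ : Type*} [NormedAddCommGroup EP] [NormedSpace ℝ EP] [TopologicalSpace HP]
    [NormedAddCommGroup EQ] [NormedSpace ℝ EQ] [TopologicalSpace HQ]
    (IP : ModelWithCorners ℝ EP HP) (K : ModelWithCorners ℝ EQ HQ)
    {P Q : Type*} [TopologicalSpace P] [ChartedSpace HP P]
    [TopologicalSpace Q] [ChartedSpace HQ Q]
    (F : Type*) [NormedAddCommGroup F] [NormedSpace ℝ F]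
    (W : Q → Type*) [TopologicalSpace (TotalSpace F W)] [∀ q, AddCommGroup (W q)]
    [∀ q, Module ℝ (W q)] [∀ q, TopologicalSpace (W q)] [FiberBundle F W] [VectorBundle ℝ F W]

variable {IP K F W} in
theorem contMDiffWithinAt_smul_add_along {b : P → Q} {S : Set P} {x : P} (a : ℝ) {c c' : ∀ p, W (b p)}
    (hc : ContMDiffWithinAt IP (K.prod 𝓘(ℝ, F)) ∞ (fun p => (⟨b p, c p⟩ : TotalSpace F W)) S x)
    (hc' : ContMDiffWithinAt IP (K.prod 𝓘(ℝ, F)) ∞ (fun p => (⟨b p, c' p⟩ : TotalSpace F W)) S x) :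
    ContMDiffWithinAt IP (K.prod 𝓘(ℝ, F)) ∞
      (fun p => (⟨b p, a • c p + c' p⟩ : TotalSpace F W)) S x := by
  rw [contMDiffWithinAt_totalSpace] at hc hc' ⊢
  refine ⟨hc.1, ?_⟩
  set e := trivializationAt F W (b x) with he
  have hx : b x ∈ e.baseSet := FiberBundle.mem_baseSet_trivializationAt F W (b x)
  have key : ∀ p, b p ∈ e.baseSet →
      (e (⟨b p, a • c p + c' p⟩ : TotalSpace F W)).2 =
        a • (e (⟨b p, c p⟩ : TotalSpace F W)).2 + (e (⟨b p, c' p⟩ : TotalSpace F W)).2 := by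
    intro p hp
    have hl := e.linear ℝ hp
    rw [hl.map_add, hl.map_smul]
  have ha : ContMDiffWithinAt IP 𝓘(ℝ, ℝ) ∞ (fun _ : P => a) S x := contMDiffWithinAt_const
  refine ((ha.smul hc.2).add hc'.2).congr_of_eventuallyEq ?_ (key x hx)
  filter_upwards [hc.1.continuousWithinAt.preimage_mem_nhdsWithin (e.open_baseSet.mem_nhds hx)]
    with p hp using key p hp

variable {IP K F W} in
theorem contMDiffWithinAt_zero_along {b : P → Q} {S : Set P} {x : P}
    (hb : ContMDiffWithinAt IP K ∞ b S x) :
    ContMDiffWithinAt IP (K.prod 𝓘(ℝ, F)) ∞ (fun p => (⟨b p, 0⟩ : TotalSpace F W)) S x := by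
  rw [contMDiffWithinAt_totalSpace]
  refine ⟨hb, ?_⟩
  set e := trivializationAt F W (b x) with he
  have hx : b x ∈ e.baseSet := FiberBundle.mem_baseSet_trivializationAt F W (b x)
  have key : ∀ p, b p ∈ e.baseSet → (e (⟨b p, 0⟩ : TotalSpace F W)).2 = 0 := by
    intro p hp
    exact (e.linear ℝ hp).map_zero
  refine (contMDiffWithinAt_const (c := (0 : F))).congr_of_eventuallyEq ?_ (key x hx)
  filter_upwards [hb.continuousWithinAt.preimage_mem_nhdsWithin (e.open_baseSet.mem_nhds hx)]
    with p hp using key p hp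

/-- The smooth sections over `P` of the pull-back `b^*W` of a vector bundle `W → Q`, that is, the
smooth maps `P → W` covering `b`. -/
def smoothSections (b : P → Q) (hb : ContMDiff IP K ∞ b) : Submodule ℝ (∀ p, W (b p)) where
  carrier := {c | ContMDiff IP (K.prod 𝓘(ℝ, F)) ∞ (fun p => (⟨b p, c p⟩ : TotalSpace F W))}
  zero_mem' := fun x => contMDiffWithinAt_zero_along (hb x)
  add_mem' := fun {c c'} hc hc' x => by
    have h := contMDiffWithinAt_smul_add_along (1 : ℝ) (hc x) (hc' x)
    simp only [one_smul] at h
    exact h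
  smul_mem' := fun a c hc x => by
    have h := contMDiffWithinAt_smul_add_along a (hc x) (contMDiffWithinAt_zero_along (F := F) (W := W) (hb x))
    simp only [add_zero] at h
    exact h

open Classical in
/-- The smooth sections of `b^*W` over a subset `S ⊆ P` (used for an embedded submanifold `S`);
the extension by zero outside `S` is immaterial. -/
def smoothSectionsOn (S : Set P) (b : P → Q) (hb : ContMDiff IP K ∞ b) :
    Submodule ℝ (∀ p : S, W (b p)) where
  carrier := {c | ContMDiffOn IP (K.prod 𝓘(ℝ, F)) ∞
    (fun p => (⟨b p, if h : p ∈ S then c ⟨p, h⟩ else 0⟩ : TotalSpace F W)) S}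
  zero_mem' := fun x _ => by
    refine (contMDiffWithinAt_zero_along (F := F) (W := W) (hb x).contMDiffWithinAt).congr_of_mem ?_ ‹_›
    intro p hp
    simp
  add_mem' := fun {c c'} hc hc' x hx => by
    refine (contMDiffWithinAt_smul_add_along (1 : ℝ) (hc x hx) (hc' x hx)).congr_of_mem ?_ hx
    intro p hp
    simp only [dif_pos hp, one_smul, Pi.add_apply]
  smul_mem' := fun a c hc x hx => by
    refine (contMDiffWithinAt_smul_add_along a (hc x hx)
      (contMDiffWithinAt_zero_along (F := F) (W := W) (hb x).contMDiffWithinAt)).congr_of_mem ?_ hx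
    intro p hp
    simp only [dif_pos hp, add_zero, Pi.smul_apply]

end SmoothSections

/-! ### VB-groupoids and their low-degree complexes -/

section VB

variable
    {EG HG EM HM : Type*} [NormedAddCommGroup EG] [NormedSpace ℝ EG] [TopologicalSpace HG]
    [NormedAddCommGroup EM] [NormedSpace ℝ EM] [TopologicalSpace HM]
    {I : ModelWithCorners ℝ EG HG} {J : ModelWithCorners ℝ EM HM}
    {G M : Type*} [TopologicalSpace G] [ChartedSpace HG G]
    [TopologicalSpace M] [ChartedSpace HM M]
    {EQ HQ EQ₀ HQ₀ : Type*} [NormedAddCommGroup EQ] [NormedSpace ℝ EQ] [TopologicalSpace HQ]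
    [NormedAddCommGroup EQ₀] [NormedSpace ℝ EQ₀] [TopologicalSpace HQ₀]

/-- Fibrewise linear structure maps of a (candidate) VB-groupoid over `𝒢`, whose total and side
bundles are presented as pull-backs `β^*W → G` and `β₀^*W₀ → M` of vector bundles along smooth
maps: for a VB-groupoid `W ⇉ W₀` over `𝒢` itself, `β` and `β₀` are identities, while for the
pull-back of the tangent groupoid along a morphism they are the components of that morphism.

`mul g h _` is defined on all of `W_g × W_h`, but only its restriction to the subspace of composable
pairs `{(v, w) | src v = tgt w}` carries information (every linear map on the subspace extends).
No groupoid law is part of this structure; see `VBGroupoid`. -/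
structure VBMaps (𝒢 : LieGroupoid I J G M)
    (K : ModelWithCorners ℝ EQ HQ) {Q : Type*} [TopologicalSpace Q] [ChartedSpace HQ Q]
    (β : G → Q) (F : Type*) (W : Q → Type*) [∀ q, AddCommGroup (W q)] [∀ q, Module ℝ (W q)]
    (K₀ : ModelWithCorners ℝ EQ₀ HQ₀) {Q₀ : Type*} [TopologicalSpace Q₀] [ChartedSpace HQ₀ Q₀]
    (β₀ : M → Q₀) (F₀ : Type*) (W₀ : Q₀ → Type*) [∀ q, AddCommGroup (W₀ q)]
    [∀ q, Module ℝ (W₀ q)] where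
  smooth_β : ContMDiff I K ∞ β
  smooth_β₀ : ContMDiff J K₀ ∞ β₀
  src : ∀ g, W (β g) →ₗ[ℝ] W₀ (β₀ (𝒢.src g))
  tgt : ∀ g, W (β g) →ₗ[ℝ] W₀ (β₀ (𝒢.tgt g))
  unit : ∀ x, W₀ (β₀ x) →ₗ[ℝ] W (β (𝒢.unit x))
  inv : ∀ g, W (β g) →ₗ[ℝ] W (β (𝒢.inv g))
  mul : ∀ g h, 𝒢.src g = 𝒢.tgt h → (W (β g) × W (β h)) →ₗ[ℝ] W (β (𝒢.mul g h))

/-- A VB-groupoid `V ⇉ E` over the Lie groupoid `𝒢 = (G ⇉ M)`: smooth vector bundles `V → G` and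
`E → M`, and a Lie groupoid structure `total` on their total spaces, all of whose structure maps are
fibrewise linear over the corresponding structure maps of `𝒢`. -/
structure VBGroupoid (𝒢 : LieGroupoid I J G M)
    (FV : Type*) [NormedAddCommGroup FV] [NormedSpace ℝ FV]
    (V : G → Type*) [TopologicalSpace (TotalSpace FV V)] [∀ g, AddCommGroup (V g)]
    [∀ g, Module ℝ (V g)] [∀ g, TopologicalSpace (V g)] [FiberBundle FV V] [VectorBundle ℝ FV V]
    [ContMDiffVectorBundle ∞ FV V I]
    (FE : Type*) [NormedAddCommGroup FE] [NormedSpace ℝ FE]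
    (E : M → Type*) [TopologicalSpace (TotalSpace FE E)] [∀ x, AddCommGroup (E x)]
    [∀ x, Module ℝ (E x)] [∀ x, TopologicalSpace (E x)] [FiberBundle FE E] [VectorBundle ℝ FE E]
    [ContMDiffVectorBundle ∞ FE E J]
    extends VBMaps 𝒢 I (fun g : G => g) FV V J (fun x : M => x) FE E where
  total : LieGroupoid (I.prod 𝓘(ℝ, FV)) (J.prod 𝓘(ℝ, FE)) (TotalSpace FV V) (TotalSpace FE E)
  total_src : ∀ g (v : V g), total.src ⟨g, v⟩ = ⟨𝒢.src g, src g v⟩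
  total_tgt : ∀ g (v : V g), total.tgt ⟨g, v⟩ = ⟨𝒢.tgt g, tgt g v⟩
  total_unit : ∀ x (e : E x), total.unit ⟨x, e⟩ = ⟨𝒢.unit x, unit x e⟩
  total_inv : ∀ g (v : V g), total.inv ⟨g, v⟩ = ⟨𝒢.inv g, inv g v⟩
  total_mul : ∀ g h (hc : 𝒢.src g = 𝒢.tgt h) (v : V g) (w : V h),
    total.src ⟨g, v⟩ = total.tgt ⟨h, w⟩ →
      total.mul ⟨g, v⟩ ⟨h, w⟩ = ⟨𝒢.mul g h, mul g h hc (v, w)⟩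

namespace VBMaps

open LieGroupoid

variable {𝒢 : LieGroupoid I J G M}
    {K : ModelWithCorners ℝ EQ HQ} {Q : Type*} [TopologicalSpace Q] [ChartedSpace HQ Q]
    {β : G → Q} {F : Type*} [NormedAddCommGroup F] [NormedSpace ℝ F]
    {W : Q → Type*} [TopologicalSpace (TotalSpace F W)] [∀ q, AddCommGroup (W q)]
    [∀ q, Module ℝ (W q)] [∀ q, TopologicalSpace (W q)] [FiberBundle F W] [VectorBundle ℝ F W]
    {K₀ : ModelWithCorners ℝ EQ₀ HQ₀} {Q₀ : Type*} [TopologicalSpace Q₀] [ChartedSpace HQ₀ Q₀]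
    {β₀ : M → Q₀} {F₀ : Type*} [NormedAddCommGroup F₀] [NormedSpace ℝ F₀]
    {W₀ : Q₀ → Type*} [TopologicalSpace (TotalSpace F₀ W₀)] [∀ q, AddCommGroup (W₀ q)]
    [∀ q, Module ℝ (W₀ q)] [∀ q, TopologicalSpace (W₀ q)] [FiberBundle F₀ W₀]
    [VectorBundle ℝ F₀ W₀]
    (𝒱 : VBMaps 𝒢 K β F W K₀ β₀ F₀ W₀)

/-! #### The VB-complex in degrees `0`, `1`, `2`

A `1`-cochain is a function `g ↦ X g ∈ V_g`, a `2`-cochain is a function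
`(g₁, g₂) ↦ c (g₁, g₂) ∈ V_{g₁}` on `G⁽²⁾`, etc.  The differentials are written on all functions;
smoothness and projectability are imposed by `C0`, `C1`, `C2`. -/

/-- `C⁰_VB = Γ(C)`: smooth sections of the core bundle `C = ker (src : V → E)` restricted to the
units. -/
def C0 : Submodule ℝ (∀ x, W (β (𝒢.unit x))) :=
  smoothSections J K F W (fun x => β (𝒢.unit x)) (𝒱.smooth_β.comp 𝒢.smooth_unit) ⊓
    Submodule.pi Set.univ fun x => LinearMap.ker (𝒱.src (𝒢.unit x))

/-- `Γ_G(V)`: smooth sections of `V → G`. -/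
def sections : Submodule ℝ (∀ g, W (β g)) :=
  smoothSections I K F W β 𝒱.smooth_β

/-- `C¹_VB`: smooth sections `X` of `V → G` which are `src`-projectable, that is, `src (X g)` only
depends on `src g`. -/
def C1 : Submodule ℝ (∀ g, W (β g)) where
  carrier := {X | X ∈ 𝒱.sections ∧ ∃ σ : ∀ x, W₀ (β₀ x), ∀ g, 𝒱.src g (X g) = σ (𝒢.src g)}
  zero_mem' := ⟨zero_mem _, 0, fun g => by simp⟩
  add_mem' := by
    rintro X Y ⟨hX, σ, hσ⟩ ⟨hY, τ, hτ⟩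
    exact ⟨add_mem hX hY, σ + τ, fun g => by simp [hσ, hτ]⟩
  smul_mem' := by
    rintro a X ⟨hX, σ, hσ⟩
    exact ⟨Submodule.smul_mem _ a hX, a • σ, fun g => by simp [hσ]⟩

/-- `C²_VB`: smooth `c : G⁽²⁾ → V` with `c (g₁, g₂) ∈ V_{g₁}`, such that `src (c (g₁, g₂))` only
depends on `g₂`. -/
def C2 : Submodule ℝ (∀ p : 𝒢.Comp2, W (β p.1.1)) where
  carrier := {c | c ∈ smoothSectionsOn (I.prod I) K F W 𝒢.Comp2 (fun p => β p.1)
      (𝒱.smooth_β.comp contMDiff_fst) ∧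
    ∃ σ : ∀ h, W₀ (β₀ (𝒢.tgt h)), ∀ p : 𝒢.Comp2,
      fibCast (fun x => W₀ (β₀ x)) p.2 (𝒱.src p.1.1 (c p)) = σ p.1.2}
  zero_mem' := ⟨zero_mem _, 0, fun g => by simp⟩
  add_mem' := by
    rintro X Y ⟨hX, σ, hσ⟩ ⟨hY, τ, hτ⟩
    exact ⟨add_mem hX hY, σ + τ, fun g => by simp [hσ, hτ]⟩
  smul_mem' := by
    rintro a X ⟨hX, σ, hσ⟩
    exact ⟨Submodule.smul_mem _ a hX, a • σ, fun g => by simp [hσ]⟩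

/-- Right translation `v ↦ v · 0_g` from the fibre over the unit at `tgt g` to the fibre
over `g`. -/
def rmul (g : G) : W (β (𝒢.unit (𝒢.tgt g))) →ₗ[ℝ] W (β g) :=
  fibCast (fun g => W (β g)) (𝒢.unit_mul g) ∘ₗ 𝒱.mul (𝒢.unit (𝒢.tgt g)) g (𝒢.src_unit _) ∘ₗ LinearMap.inl ℝ _ _

/-- `v ↦ 0_g · v⁻¹` from the fibre over the unit at `src g` to the fibre over `g`. -/
def lmulInv (g : G) : W (β (𝒢.unit (𝒢.src g))) →ₗ[ℝ] W (β g) :=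
  fibCast (fun g => W (β g)) (𝒢.mul_inv_unit g) ∘ₗ
    𝒱.mul g (𝒢.inv (𝒢.unit (𝒢.src g))) (by rw [𝒢.tgt_inv, 𝒢.src_unit]) ∘ₗ
      LinearMap.inr ℝ _ _ ∘ₗ 𝒱.inv (𝒢.unit (𝒢.src g))

/-- The division `(v, w) ↦ v · w⁻¹` from `V_{gh} × V_h` to `V_g`. -/
def div (g h : G) (hc : 𝒢.src g = 𝒢.tgt h) :
    (W (β (𝒢.mul g h)) × W (β h)) →ₗ[ℝ] W (β g) :=
  fibCast (fun g => W (β g)) (𝒢.mul_mul_inv hc) ∘ₗ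
    𝒱.mul (𝒢.mul g h) (𝒢.inv h) ((𝒢.src_mul g h hc).trans (𝒢.tgt_inv h).symm) ∘ₗ
      LinearMap.prodMap LinearMap.id (𝒱.inv h)

/-- `(δα)(g) = α_{tgt g} · 0_g + 0_g · (α_{src g})⁻¹`. -/
def d0 : (∀ x, W (β (𝒢.unit x))) →ₗ[ℝ] (∀ g, W (β g)) where
  toFun α g := 𝒱.rmul g (α (𝒢.tgt g)) + 𝒱.lmulInv g (α (𝒢.src g))
  map_add' α α' := by
    ext g
    simp only [Pi.add_apply, map_add]
    abel
  map_smul' a α := by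
    ext g
    simp only [Pi.smul_apply, map_smul, smul_add, RingHom.id_apply]

/-- `(δX)(g₁, g₂) = - X(g₁g₂) · X(g₂)⁻¹ + X(g₁)`. -/
def d1 : (∀ g, W (β g)) →ₗ[ℝ] (∀ p : 𝒢.Comp2, W (β p.1.1)) where
  toFun X p := - 𝒱.div p.1.1 p.1.2 p.2 (X (𝒢.mul p.1.1 p.1.2), X p.1.2) + X p.1.1
  map_add' X X' := by
    ext p
    simp only [Pi.add_apply, ← Prod.mk_add_mk, map_add]
    abel
  map_smul' a X := by
    ext p
    simp only [Pi.smul_apply, ← Prod.smul_mk, map_smul, smul_add, smul_neg, RingHom.id_apply]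

/-- `(δc)(g₁, g₂, g₃) = - c(g₁g₂, g₃) · c(g₂, g₃)⁻¹ + c(g₁, g₂g₃) - c(g₁, g₂)`. -/
def d2 : (∀ p : 𝒢.Comp2, W (β p.1.1)) →ₗ[ℝ] (∀ p : 𝒢.Comp3, W (β p.1.1)) where
  toFun c p := - 𝒱.div p.1.1 p.1.2.1 p.2.1 (c (face1 p), c (face0 p)) + c (face2 p) - c (face3 p)
  map_add' c c' := by
    ext p
    simp only [Pi.add_apply, ← Prod.mk_add_mk, map_add]
    abel
  map_smul' a c := by
    ext p
    simp only [Pi.smul_apply, ← Prod.smul_mk, map_smul, smul_add, smul_neg, smul_sub,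
      RingHom.id_apply]

/-- `1`-cocycles of the VB-complex. -/
def Z1 : Submodule ℝ (∀ g, W (β g)) := 𝒱.C1 ⊓ LinearMap.ker 𝒱.d1

/-- `1`-coboundaries of the VB-complex. -/
def B1 : Submodule ℝ (∀ g, W (β g)) := 𝒱.C0.map 𝒱.d0

/-- `2`-cocycles of the VB-complex. -/
def Z2 : Submodule ℝ (∀ p : 𝒢.Comp2, W (β p.1.1)) := 𝒱.C2 ⊓ LinearMap.ker 𝒱.d2

/-- `2`-coboundaries of the VB-complex. -/
def B2 : Submodule ℝ (∀ p : 𝒢.Comp2, W (β p.1.1)) := 𝒱.C1.map 𝒱.d1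

/-- `H¹_VB(𝒢, V)`. -/
abbrev H1 : Type _ := 𝒱.Z1 ⧸ 𝒱.B1.submoduleOf 𝒱.Z1

/-- `H²_VB(𝒢, V)`. -/
abbrev H2 : Type _ := 𝒱.Z2 ⧸ 𝒱.B2.submoduleOf 𝒱.Z2

/-! #### Cochains with values in `𝔨 = ker (∂ : C → E)` -/

/-- `𝔨_x`: the vectors `v` in the fibre over the unit at `x` with `src v = 0` (so `v ∈ C_x`) and
`∂ v = tgt v = 0`. -/
def kfib (x : M) : Submodule ℝ (W (β (𝒢.unit x))) :=
  LinearMap.ker (𝒱.src (𝒢.unit x)) ⊓ LinearMap.ker (𝒱.tgt (𝒢.unit x))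

/-- `C⁰(𝒢, 𝔨)`: smooth sections of `C` with values in `𝔨`. -/
def kC0 : Submodule ℝ (∀ x, W (β (𝒢.unit x))) :=
  smoothSections J K F W (fun x => β (𝒢.unit x)) (𝒱.smooth_β.comp 𝒢.smooth_unit) ⊓
    Submodule.pi Set.univ fun x => 𝒱.kfib x

/-- `C¹(𝒢, 𝔨)`: smooth sections of `tgt^*C → G` with values in `𝔨`. -/
def kC1 : Submodule ℝ (∀ g, W (β (𝒢.unit (𝒢.tgt g)))) :=
  smoothSections I K F W (fun g => β (𝒢.unit (𝒢.tgt g)))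
      (𝒱.smooth_β.comp (𝒢.smooth_unit.comp 𝒢.smooth_tgt)) ⊓
    Submodule.pi Set.univ fun g => 𝒱.kfib (𝒢.tgt g)

/-- `C²(𝒢, 𝔨)`: smooth sections over `G⁽²⁾` of the pull-back of `C` along `(g₁, g₂) ↦ tgt g₁`, with
values in `𝔨`. -/
def kC2 : Submodule ℝ (∀ p : 𝒢.Comp2, W (β (𝒢.unit (𝒢.tgt p.1.1)))) :=
  smoothSectionsOn (I.prod I) K F W 𝒢.Comp2 (fun p => β (𝒢.unit (𝒢.tgt p.1)))
      (𝒱.smooth_β.comp (𝒢.smooth_unit.comp (𝒢.smooth_tgt.comp contMDiff_fst))) ⊓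
    Submodule.pi Set.univ fun p => 𝒱.kfib (𝒢.tgt p.1.1)

/-- The action `g · v = 0_g · v · 0_{g⁻¹}` on `𝔨`. -/
def act (g : G) : W (β (𝒢.unit (𝒢.src g))) →ₗ[ℝ] W (β (𝒢.unit (𝒢.tgt g))) :=
  fibCast (fun g => W (β g)) (𝒢.conj_unit g) ∘ₗ
    𝒱.mul (𝒢.mul g (𝒢.unit (𝒢.src g))) (𝒢.inv g) (by rw [𝒢.mul_unit, 𝒢.tgt_inv]) ∘ₗ
      LinearMap.inl ℝ _ _ ∘ₗ
        𝒱.mul g (𝒢.unit (𝒢.src g)) (𝒢.tgt_unit _).symm ∘ₗ LinearMap.inr ℝ _ _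

/-- `(δα)(g) = g · α(src g) - α(tgt g)`. -/
def kd0 : (∀ x, W (β (𝒢.unit x))) →ₗ[ℝ] (∀ g, W (β (𝒢.unit (𝒢.tgt g)))) where
  toFun α g := 𝒱.act g (α (𝒢.src g)) - α (𝒢.tgt g)
  map_add' α α' := by
    ext g
    simp only [Pi.add_apply, map_add]
    abel
  map_smul' a α := by
    ext g
    simp only [Pi.smul_apply, map_smul, smul_sub, RingHom.id_apply]

/-- `(δe)(g₁, g₂) = g₁ · e(g₂) - e(g₁g₂) + e(g₁)`. -/
def kd1 : (∀ g, W (β (𝒢.unit (𝒢.tgt g)))) →ₗ[ℝ]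
    (∀ p : 𝒢.Comp2, W (β (𝒢.unit (𝒢.tgt p.1.1)))) where
  toFun e p := 𝒱.act p.1.1 (fibCast (fun x => W (β (𝒢.unit x))) p.2.symm (e p.1.2))
    - fibCast (fun x => W (β (𝒢.unit x))) (𝒢.tgt_mul _ _ p.2) (e (𝒢.mul p.1.1 p.1.2)) + e p.1.1
  map_add' e e' := by
    ext p
    simp only [Pi.add_apply, map_add]
    abel
  map_smul' a e := by
    ext p
    simp only [Pi.smul_apply, map_smul, smul_add, smul_sub, RingHom.id_apply]

/-- `(δe)(g₁, g₂, g₃) = g₁ · e(g₂, g₃) - e(g₁g₂, g₃) + e(g₁, g₂g₃) - e(g₁, g₂)`. -/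
def kd2 : (∀ p : 𝒢.Comp2, W (β (𝒢.unit (𝒢.tgt p.1.1)))) →ₗ[ℝ]
    (∀ p : 𝒢.Comp3, W (β (𝒢.unit (𝒢.tgt p.1.1)))) where
  toFun e p := 𝒱.act p.1.1 (fibCast (fun x => W (β (𝒢.unit x))) p.2.1.symm (e (face0 p)))
    - fibCast (fun x => W (β (𝒢.unit x))) (𝒢.tgt_mul _ _ p.2.1) (e (face1 p)) + e (face2 p) - e (face3 p)
  map_add' e e' := by
    ext p
    simp only [Pi.add_apply, map_add]
    abel
  map_smul' a e := by
    ext p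
    simp only [Pi.smul_apply, map_smul, smul_add, smul_sub, RingHom.id_apply]

/-- `1`-cocycles with values in `𝔨`. -/
def kZ1 : Submodule ℝ (∀ g, W (β (𝒢.unit (𝒢.tgt g)))) := 𝒱.kC1 ⊓ LinearMap.ker 𝒱.kd1

/-- `1`-coboundaries with values in `𝔨`. -/
def kB1 : Submodule ℝ (∀ g, W (β (𝒢.unit (𝒢.tgt g)))) := 𝒱.kC0.map 𝒱.kd0

/-- `2`-cocycles with values in `𝔨`. -/
def kZ2 : Submodule ℝ (∀ p : 𝒢.Comp2, W (β (𝒢.unit (𝒢.tgt p.1.1)))) :=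
  𝒱.kC2 ⊓ LinearMap.ker 𝒱.kd2

/-- `2`-coboundaries with values in `𝔨`. -/
def kB2 : Submodule ℝ (∀ p : 𝒢.Comp2, W (β (𝒢.unit (𝒢.tgt p.1.1)))) := 𝒱.kC1.map 𝒱.kd1

/-- `H¹(𝒢, 𝔨)`. -/
abbrev kH1 : Type _ := 𝒱.kZ1 ⧸ 𝒱.kB1.submoduleOf 𝒱.kZ1

/-- `H²(𝒢, 𝔨)`. -/
abbrev kH2 : Type _ := 𝒱.kZ2 ⧸ 𝒱.kB2.submoduleOf 𝒱.kZ2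

/-! #### Sections of `𝔩 = coker (∂ : C → E)` and the exact sequence -/

/-- `Γ(E)`: smooth sections of the side bundle. -/
def sideSections : Submodule ℝ (∀ x, W₀ (β₀ x)) :=
  smoothSections J K₀ F₀ W₀ β₀ 𝒱.smooth_β₀

/-- The core-anchor `∂` on sections, `(∂α)(x) = tgt (α x)`. -/
def anchor : (∀ x, W (β (𝒢.unit x))) →ₗ[ℝ] (∀ x, W₀ (β₀ x)) :=
  LinearMap.pi fun x =>
    fibCast (fun x => W₀ (β₀ x)) (𝒢.tgt_unit x) ∘ₗ 𝒱.tgt (𝒢.unit x) ∘ₗ LinearMap.proj x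

/-- `Γ(𝔩) = Γ(E) / ∂ Γ(C)`. -/
abbrev lSections : Type _ :=
  𝒱.sideSections ⧸ (𝒱.C0.map 𝒱.anchor).submoduleOf 𝒱.sideSections

/-- `X` is a `(src, tgt)`-lift of the section `s` of `E`. -/
def IsLift (X : ∀ g, W (β g)) (s : ∀ x, W₀ (β₀ x)) : Prop :=
  ∀ g, 𝒱.src g (X g) = s (𝒢.src g) ∧ 𝒱.tgt g (X g) = s (𝒢.tgt g)

/-- The smooth sections of `E` which admit a smooth `(src, tgt)`-lift. -/
def liftable : Submodule ℝ 𝒱.sideSections where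
  carrier := {s | ∃ X ∈ 𝒱.sections, 𝒱.IsLift X s}
  zero_mem' := ⟨0, zero_mem _, fun g => by simp⟩
  add_mem' := by
    rintro s s' ⟨X, hX, h⟩ ⟨X', hX', h'⟩
    exact ⟨X + X', add_mem hX hX', fun g => by simp [(h g).1, (h g).2, (h' g).1, (h' g).2]⟩
  smul_mem' := by
    rintro a s ⟨X, hX, h⟩
    exact ⟨a • X, Submodule.smul_mem _ a hX, fun g => by simp [(h g).1, (h g).2]⟩

/-- `Γ(𝔩)^inv`: the classes `[s] ∈ Γ(𝔩)` of sections `s` of `E` admitting a smooth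
`(src, tgt)`-lift. -/
def lInv : Submodule ℝ 𝒱.lSections := 𝒱.liftable.map (Submodule.mkQ _)

/-- The map `r` on functions of degree one, `(r e)(g) = e(g) · 0_g`. -/
def r1 (e : ∀ g, W (β (𝒢.unit (𝒢.tgt g)))) (g : G) : W (β g) := 𝒱.rmul g (e g)

/-- The map `r` on functions of degree two, `(r e)(g₁, g₂) = e(g₁, g₂) · 0_{g₁}`. -/
def r2 (e : ∀ p : 𝒢.Comp2, W (β (𝒢.unit (𝒢.tgt p.1.1)))) (p : 𝒢.Comp2) : W (β p.1.1) :=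
  𝒱.rmul p.1.1 (e p)

/-- There is an exact sequence
`0 → H¹(𝒢, 𝔨) → H¹_VB(𝒢, V) → Γ(𝔩)^inv → H²(𝒢, 𝔨) → H²_VB(𝒢, V)`
of real vector spaces whose maps `ρ₁, pr, κ, ρ₂` are given on representatives as follows:
`ρ₁` and `ρ₂` are induced by `r`; `pr` sends the class of a cocycle to the class of its
`src`-projection; `κ` sends `[s]` to the class of the cocycle `e` with `r e = δX`, for any smooth
`(src, tgt)`-lift `X` of `s`. -/
def LowDegreeExactSequence : Prop :=
  ∃ (ρ₁ : 𝒱.kH1 →ₗ[ℝ] 𝒱.H1) (pr : 𝒱.H1 →ₗ[ℝ] 𝒱.lInv) (κ : 𝒱.lInv →ₗ[ℝ] 𝒱.kH2)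
    (ρ₂ : 𝒱.kH2 →ₗ[ℝ] 𝒱.H2),
    (∀ e : 𝒱.kZ1, ∃ c : 𝒱.Z1, c.1 = 𝒱.r1 e.1 ∧
      ρ₁ (Submodule.Quotient.mk e) = Submodule.Quotient.mk c) ∧
    (∀ c : 𝒱.Z1, ∃ s : 𝒱.sideSections, (∀ g, 𝒱.src g (c.1 g) = s.1 (𝒢.src g)) ∧
      (pr (Submodule.Quotient.mk c) : 𝒱.lSections) = Submodule.Quotient.mk s) ∧
    (∀ (ℓ : 𝒱.lInv) (s : 𝒱.sideSections) (X : 𝒱.sections), 𝒱.IsLift X.1 s.1 →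
      (ℓ : 𝒱.lSections) = Submodule.Quotient.mk s →
        ∃ e : 𝒱.kZ2, 𝒱.r2 e.1 = 𝒱.d1 X.1 ∧ κ ℓ = Submodule.Quotient.mk e) ∧
    (∀ e : 𝒱.kZ2, ∃ c : 𝒱.Z2, c.1 = 𝒱.r2 e.1 ∧
      ρ₂ (Submodule.Quotient.mk e) = Submodule.Quotient.mk c) ∧
    Function.Injective ρ₁ ∧ Function.Exact ρ₁ pr ∧ Function.Exact pr κ ∧ Function.Exact κ ρ₂

end VBMaps

/-! ### The pull-back of the tangent groupoid along a morphism -/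

variable
    {EH HH EN HN : Type*} [NormedAddCommGroup EH] [NormedSpace ℝ EH] [TopologicalSpace HH]
    [NormedAddCommGroup EN] [NormedSpace ℝ EN] [TopologicalSpace HN]
    {I' : ModelWithCorners ℝ EH HH} {J' : ModelWithCorners ℝ EN HN}
    {H N : Type*} [TopologicalSpace H] [ChartedSpace HH H]
    [TopologicalSpace N] [ChartedSpace HN N]
    {ℋ : LieGroupoid I' J' H N} {𝒢 : LieGroupoid I J G M}

/-- The structure maps of the VB-groupoid `Φ^*T𝒢` over `ℋ`, for a morphism `(Φ, φ) : ℋ → 𝒢`: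
the fibres are `T_{Φ(h)}G` and `T_{φ(y)}M`, and the structure maps are the differentials of those
of `𝒢`.  The differential of the multiplication is taken within the submanifold `G⁽²⁾ ⊆ G × G`; on
vectors tangent to `G⁽²⁾` it is the usual one.  Its VB-complex is the deformation complex of `Φ`,
its `𝔨` is the pull-back of the isotropy bundle and its `𝔩` the pull-back of the normal bundle. -/
def LieGroupoid.Hom.pullbackTangent (Φ : LieGroupoid.Hom ℋ 𝒢) :
    VBMaps ℋ I Φ.toFun EG (TangentSpace I : G → Type _) J Φ.base EM
      (TangentSpace J : M → Type _) where
  smooth_β := Φ.smooth_toFun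
  smooth_β₀ := Φ.smooth_base
  src h := fibCast (TangentSpace J : M → Type _) (Φ.map_src h) ∘ₗ
    (mfderiv I J 𝒢.src (Φ.toFun h)).toLinearMap
  tgt h := fibCast (TangentSpace J : M → Type _) (Φ.map_tgt h) ∘ₗ
    (mfderiv I J 𝒢.tgt (Φ.toFun h)).toLinearMap
  unit y := fibCast (TangentSpace I : G → Type _)
      (Φ.map_unit y).symm ∘ₗ (mfderiv J I 𝒢.unit (Φ.base y)).toLinearMap
  inv h := fibCast (TangentSpace I : G → Type _) (Φ.map_inv h) ∘ₗ
    (mfderiv I I 𝒢.inv (Φ.toFun h)).toLinearMap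
  mul h k hc := fibCast (TangentSpace I : G → Type _)
      (Φ.map_mul h k hc).symm ∘ₗ
    (mfderivWithin (I.prod I) I (fun p : G × G => 𝒢.mul p.1 p.2) 𝒢.Comp2
      (Φ.toFun h, Φ.toFun k)).toLinearMap

end VB

end

set_option linter.unusedSectionVars false

/-! Right translation `v ↦ v · 0_g` maps `𝔨_{t(g)}` bijectively onto the vectors of `V_g` with
vanishing source and target; its inverse is `w ↦ w · 0_g⁻¹`. Both are groupoid operations and hence
preserve smoothness, so in degrees 1 and 2 `r` identifies the `𝔨`-valued cochains with the
VB-cochains of vanishing source and target (`exists_r1_eq`, `exists_r2_eq`). This works although `𝔨`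
need not be a vector bundle. Linearity of the multiplication forces `v⁻¹ = -v` on `𝔨`
(`inv_kernel`), and this makes `r` commute with the differentials (`d1_r1`, `d2_r2`), up to a sign
in degree 0 (`d0_eq_neg_r1`).

Two facts connect cochains with sections of `E`. If `X` projects to `σ`, the source of `δX` at `(g,
h)` is `σ(t(h)) - t(X_h)`, so it vanishes everywhere exactly when `X` is a lift of `σ`
(`isLift_iff_src_d1_eq_zero`), and then the target of `δX` vanishes too (`tgt_d1`). And `δα` is a
lift of `∂α` (`isLift_d0`). Hence 1-cocycles are lifts of their projections, `δX = r e` for every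
lift `X`, and the lifts of `0` are the cochains `r e`. Exactness in `lowDegreeExactSequence` follows
by correcting lifts by some `δα` or `r e`.

All this uses only a groupoid with smooth structure maps on the total spaces that induces the
fibrewise maps, recorded as a `Realization`. For a VB-groupoid this is its total groupoid. For
`Φ^*T𝒢` it is the tangent groupoid `TG ⇉ TM` itself, so the pull-back need not be constructed as a
manifold. The laws of `TG` come from differentiating those of `G` along composable curves, and the
smoothness of its multiplication from a local extension of `mul` to an open set; both rest on the
source being a submersion (`exists_local_lift`). -/

/-- A total, single-valued linear relation is the graph of a linear map. -/
theorem exists_linearMap_of_relation {A B : Type*} [AddCommGroup A] [Module ℝ A] [AddCommGroup B]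
    [Module ℝ B] (r : A → B → Prop) (add : ∀ a b a' b', r a b → r a' b' → r (a + a') (b + b'))
    (smul : ∀ (t : ℝ) a b, r a b → r (t • a) (t • b)) (total : ∀ a, ∃ b, r a b)
    (zero : ∀ b, r 0 b → b = 0) : ∃ f : A →ₗ[ℝ] B, ∀ a b, r a b ↔ f a = b := by
  choose f hf using total
  have uniq : ∀ a b b', r a b → r a b' → b = b' := by
    intro a b b' h h'
    have h2 := add _ _ _ _ h (smul (-1) _ _ h')
    rw [neg_smul, one_smul, neg_smul, one_smul, add_neg_cancel] at h2
    exact add_neg_eq_zero.1 (zero _ h2)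
  refine ⟨⟨⟨f, fun a a' => uniq _ _ _ (hf _) (add _ _ _ _ (hf a) (hf a'))⟩,
    fun t a => uniq _ _ _ (hf _) (smul t _ _ (hf a))⟩, fun a b => ⟨fun h => uniq _ _ _ (hf a) h, ?_⟩⟩
  rintro rfl
  exact hf a

/-! ### Smooth groupoids and the calculus of division -/

/-- A groupoid `G ⇉ M` on manifolds with smooth structure maps.  In contrast to `LieGroupoid`,
source and target are not required to be submersions. -/
structure SmoothGroupoid
    {EG HG EM HM : Type*} [NormedAddCommGroup EG] [NormedSpace ℝ EG] [TopologicalSpace HG]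
    [NormedAddCommGroup EM] [NormedSpace ℝ EM] [TopologicalSpace HM]
    (I : ModelWithCorners ℝ EG HG) (J : ModelWithCorners ℝ EM HM)
    (G M : Type*) [TopologicalSpace G] [ChartedSpace HG G]
    [TopologicalSpace M] [ChartedSpace HM M] where
  src : G → M
  tgt : G → M
  unit : M → G
  inv : G → G
  mul : G → G → G
  src_unit : ∀ x, src (unit x) = x
  tgt_unit : ∀ x, tgt (unit x) = x
  src_inv : ∀ g, src (inv g) = tgt g
  tgt_inv : ∀ g, tgt (inv g) = src g
  src_mul : ∀ g h, src g = tgt h → src (mul g h) = src h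
  tgt_mul : ∀ g h, src g = tgt h → tgt (mul g h) = tgt g
  mul_assoc : ∀ g h k, src g = tgt h → src h = tgt k → mul (mul g h) k = mul g (mul h k)
  unit_mul : ∀ g, mul (unit (tgt g)) g = g
  mul_unit : ∀ g, mul g (unit (src g)) = g
  inv_mul : ∀ g, mul (inv g) g = unit (src g)
  mul_inv : ∀ g, mul g (inv g) = unit (tgt g)
  smooth_src : ContMDiff I J ∞ src
  smooth_unit : ContMDiff J I ∞ unit
  smooth_inv : ContMDiff I I ∞ inv
  smooth_mul : ContMDiffOn (I.prod I) I ∞ (fun p : G × G => mul p.1 p.2)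
    {p : G × G | src p.1 = tgt p.2}

namespace SmoothGroupoid

variable
    {EG HG EM HM : Type*} [NormedAddCommGroup EG] [NormedSpace ℝ EG] [TopologicalSpace HG]
    [NormedAddCommGroup EM] [NormedSpace ℝ EM] [TopologicalSpace HM]
    {I : ModelWithCorners ℝ EG HG} {J : ModelWithCorners ℝ EM HM}
    {G M : Type*} [TopologicalSpace G] [ChartedSpace HG G]
    [TopologicalSpace M] [ChartedSpace HM M]
    (𝒯 : SmoothGroupoid I J G M)

theorem contMDiffOn_mul {EP HP : Type*} [NormedAddCommGroup EP] [NormedSpace ℝ EP]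
    [TopologicalSpace HP] {IP : ModelWithCorners ℝ EP HP} {P : Type*} [TopologicalSpace P]
    [ChartedSpace HP P] {S : Set P} {f f' : P → G} (hf : ContMDiffOn IP I ∞ f S)
    (hf' : ContMDiffOn IP I ∞ f' S) (hc : ∀ p ∈ S, 𝒯.src (f p) = 𝒯.tgt (f' p)) :
    ContMDiffOn IP I ∞ (fun p => 𝒯.mul (f p) (f' p)) S :=
  𝒯.smooth_mul.comp (hf.prodMk hf') hc

theorem mul_mul_inv {g h : G} (hc : 𝒯.src g = 𝒯.tgt h) :
    𝒯.mul (𝒯.mul g h) (𝒯.inv h) = g := by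
  rw [𝒯.mul_assoc g h _ hc (𝒯.tgt_inv h).symm, 𝒯.mul_inv, ← hc, 𝒯.mul_unit]

theorem mul_inv_mul {g h : G} (hc : 𝒯.src g = 𝒯.src h) :
    𝒯.mul (𝒯.mul g (𝒯.inv h)) h = g := by
  rw [𝒯.mul_assoc g _ h (hc.trans (𝒯.tgt_inv h).symm) (𝒯.src_inv h), 𝒯.inv_mul, ← hc, 𝒯.mul_unit]

theorem mul_right_cancel {g g' h : G} (hg : 𝒯.src g = 𝒯.tgt h) (hg' : 𝒯.src g' = 𝒯.tgt h)
    (e : 𝒯.mul g h = 𝒯.mul g' h) : g = g' := by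
  rw [← 𝒯.mul_mul_inv hg, e, 𝒯.mul_mul_inv hg']

/-- The division `g h⁻¹`. -/
def div (g h : G) : G := 𝒯.mul g (𝒯.inv h)

theorem contMDiffOn_div {EP HP : Type*} [NormedAddCommGroup EP] [NormedSpace ℝ EP]
    [TopologicalSpace HP] {IP : ModelWithCorners ℝ EP HP} {P : Type*} [TopologicalSpace P]
    [ChartedSpace HP P] {S : Set P} {f f' : P → G} (hf : ContMDiffOn IP I ∞ f S)
    (hf' : ContMDiffOn IP I ∞ f' S) (hc : ∀ p ∈ S, 𝒯.src (f p) = 𝒯.src (f' p)) :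
    ContMDiffOn IP I ∞ (fun p => 𝒯.div (f p) (f' p)) S :=
  𝒯.contMDiffOn_mul hf (𝒯.smooth_inv.comp_contMDiffOn hf') fun p hp => by
    rw [hc p hp, 𝒯.tgt_inv]

theorem src_div {g h : G} (hc : 𝒯.src g = 𝒯.src h) : 𝒯.src (𝒯.div g h) = 𝒯.tgt h := by
  rw [div, 𝒯.src_mul _ _ (by rw [hc, 𝒯.tgt_inv]), 𝒯.src_inv]

theorem tgt_div {g h : G} (hc : 𝒯.src g = 𝒯.src h) : 𝒯.tgt (𝒯.div g h) = 𝒯.tgt g :=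
  𝒯.tgt_mul _ _ (by rw [hc, 𝒯.tgt_inv])

theorem div_mul_cancel {g h : G} (hc : 𝒯.src g = 𝒯.src h) : 𝒯.mul (𝒯.div g h) h = g :=
  𝒯.mul_inv_mul hc

theorem mul_div_cancel {g h : G} (hc : 𝒯.src g = 𝒯.tgt h) : 𝒯.div (𝒯.mul g h) h = g :=
  𝒯.mul_mul_inv hc

/-- Right multiplication by `h = (h k⁻¹) k` turns both sides into `g`. This cancellation of a common
divisor is what makes consecutive VB-differentials compose to zero. -/
theorem div_div_div {g h k : G} (h1 : 𝒯.src g = 𝒯.src k) (h2 : 𝒯.src h = 𝒯.src k) :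
    𝒯.div (𝒯.div g k) (𝒯.div h k) = 𝒯.div g h := by
  have e : 𝒯.src (𝒯.div g k) = 𝒯.src (𝒯.div h k) := by rw [𝒯.src_div h1, 𝒯.src_div h2]
  apply 𝒯.mul_right_cancel (h := h)
  · rw [𝒯.src_div e, 𝒯.tgt_div h2]
  · rw [𝒯.src_div (h1.trans h2.symm)]
  · rw [𝒯.div_mul_cancel (h1.trans h2.symm)]
    have e2 := 𝒯.mul_assoc _ _ _ (𝒯.src_div e) (𝒯.src_div h2)
    rwa [𝒯.div_mul_cancel h2, 𝒯.div_mul_cancel e, 𝒯.div_mul_cancel h1, eq_comm] at e2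

theorem mul_div_mul {g h k : G} (h1 : 𝒯.src g = 𝒯.tgt k) (h2 : 𝒯.src h = 𝒯.tgt k) :
    𝒯.div (𝒯.mul g k) (𝒯.mul h k) = 𝒯.div g h := by
  rw [← 𝒯.div_div_div (k := k) (by rw [𝒯.src_mul _ _ h1]) (by rw [𝒯.src_mul _ _ h2]),
    𝒯.mul_div_cancel h1, 𝒯.mul_div_cancel h2]

theorem mul_div_assoc {g h k : G} (h1 : 𝒯.src g = 𝒯.tgt h) (h2 : 𝒯.src h = 𝒯.src k) :
    𝒯.div (𝒯.mul g h) k = 𝒯.mul g (𝒯.div h k) :=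
  𝒯.mul_assoc _ _ _ h1 (by rw [h2, 𝒯.tgt_inv])

end SmoothGroupoid

/-- A Lie groupoid is in particular a smooth groupoid. -/
def LieGroupoid.toSmoothGroupoid
    {EG HG EM HM : Type*} [NormedAddCommGroup EG] [NormedSpace ℝ EG] [TopologicalSpace HG]
    [NormedAddCommGroup EM] [NormedSpace ℝ EM] [TopologicalSpace HM]
    {I : ModelWithCorners ℝ EG HG} {J : ModelWithCorners ℝ EM HM}
    {G M : Type*} [TopologicalSpace G] [ChartedSpace HG G]
    [TopologicalSpace M] [ChartedSpace HM M] (𝒢 : LieGroupoid I J G M) :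
    SmoothGroupoid I J G M where
  __ := 𝒢

/-! ### Realizations by a groupoid on the total spaces -/

section

variable
    {EG HG EM HM : Type*} [NormedAddCommGroup EG] [NormedSpace ℝ EG] [TopologicalSpace HG]
    [NormedAddCommGroup EM] [NormedSpace ℝ EM] [TopologicalSpace HM]
    {I : ModelWithCorners ℝ EG HG} {J : ModelWithCorners ℝ EM HM}
    {G M : Type*} [TopologicalSpace G] [ChartedSpace HG G]
    [TopologicalSpace M] [ChartedSpace HM M]
    {EQ HQ EQ₀ HQ₀ : Type*} [NormedAddCommGroup EQ] [NormedSpace ℝ EQ] [TopologicalSpace HQ]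
    [NormedAddCommGroup EQ₀] [NormedSpace ℝ EQ₀] [TopologicalSpace HQ₀]
    {𝒢 : LieGroupoid I J G M}
    {K : ModelWithCorners ℝ EQ HQ} {Q : Type*} [TopologicalSpace Q] [ChartedSpace HQ Q]
    {β : G → Q} {F : Type*} [NormedAddCommGroup F] [NormedSpace ℝ F]
    {W : Q → Type*} [TopologicalSpace (TotalSpace F W)] [∀ q, AddCommGroup (W q)]
    [∀ q, Module ℝ (W q)] [∀ q, TopologicalSpace (W q)] [FiberBundle F W] [VectorBundle ℝ F W]
    {K₀ : ModelWithCorners ℝ EQ₀ HQ₀} {Q₀ : Type*} [TopologicalSpace Q₀] [ChartedSpace HQ₀ Q₀]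
    {β₀ : M → Q₀} {F₀ : Type*} [NormedAddCommGroup F₀] [NormedSpace ℝ F₀]
    {W₀ : Q₀ → Type*} [TopologicalSpace (TotalSpace F₀ W₀)] [∀ q, AddCommGroup (W₀ q)]
    [∀ q, Module ℝ (W₀ q)] [∀ q, TopologicalSpace (W₀ q)] [FiberBundle F₀ W₀]
    [VectorBundle ℝ F₀ W₀]

/-- A realization of fibrewise linear structure maps by a smooth groupoid on the total spaces of the
vector bundles `W` and `W₀`. -/
structure VBMaps.Realization (𝒱 : VBMaps 𝒢 K β F W K₀ β₀ F₀ W₀) where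
  total : SmoothGroupoid (K.prod 𝓘(ℝ, F)) (K₀.prod 𝓘(ℝ, F₀)) (TotalSpace F W) (TotalSpace F₀ W₀)
  total_src : ∀ g (v : W (β g)), total.src ⟨β g, v⟩ = ⟨β₀ (𝒢.src g), 𝒱.src g v⟩
  total_tgt : ∀ g (v : W (β g)), total.tgt ⟨β g, v⟩ = ⟨β₀ (𝒢.tgt g), 𝒱.tgt g v⟩
  total_unit : ∀ x (e : W₀ (β₀ x)), total.unit ⟨β₀ x, e⟩ = ⟨β (𝒢.unit x), 𝒱.unit x e⟩
  total_inv : ∀ g (v : W (β g)), total.inv ⟨β g, v⟩ = ⟨β (𝒢.inv g), 𝒱.inv g v⟩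
  total_mul : ∀ g h (hc : 𝒢.src g = 𝒢.tgt h) (v : W (β g)) (w : W (β h)),
    total.src ⟨β g, v⟩ = total.tgt ⟨β h, w⟩ →
      total.mul ⟨β g, v⟩ ⟨β h, w⟩ = ⟨β (𝒢.mul g h), 𝒱.mul g h hc (v, w)⟩

theorem fibCast_eq_zero {ι : Type*} (A : ι → Type*) [∀ i, AddCommGroup (A i)]
    [∀ i, Module ℝ (A i)] {i j : ι} (h : i = j) {v : A i} : fibCast A h v = 0 ↔ v = 0 := by
  subst h; rfl

theorem fibCast_section {ι : Type*} {A : ι → Type*} [∀ i, AddCommGroup (A i)]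
    [∀ i, Module ℝ (A i)] (s : ∀ i, A i) {i j : ι} (h : i = j) : fibCast A h (s i) = s j := by
  subst h; rfl

/-- Transport between fibres over equal indices is invisible in the total space. Together with
`mk_inj` this turns identities between vectors into identities in the total groupoid, where no
transports occur. -/
theorem mk_fibCast {ι Q : Type*} (F : Type*) (W : Q → Type*) [∀ q, AddCommGroup (W q)]
    [∀ q, Module ℝ (W q)] (b : ι → Q) {i j : ι} (h : i = j) (v : W (b i)) :
    (⟨b j, fibCast (fun i => W (b i)) h v⟩ : TotalSpace F W) = ⟨b i, v⟩ := by
  subst h; rfl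

theorem mk_inj {Q : Type*} (F : Type*) {W : Q → Type*} {q : Q} {v w : W q}
    (h : (⟨q, v⟩ : TotalSpace F W) = ⟨q, w⟩) : v = w :=
  eq_of_heq (TotalSpace.mk.inj h).2

/-! ### Translations, division and the action on `𝔨`, fibre by fibre -/

namespace VBMaps.Realization

variable {𝒱 : VBMaps 𝒢 K β F W K₀ β₀ F₀ W₀} (R : 𝒱.Realization)

include R

theorem src_zero (g : G) : R.total.src ⟨β g, 0⟩ = ⟨β₀ (𝒢.src g), 0⟩ := by
  rw [R.total_src, map_zero]

theorem tgt_zero (g : G) : R.total.tgt ⟨β g, 0⟩ = ⟨β₀ (𝒢.tgt g), 0⟩ := by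
  rw [R.total_tgt, map_zero]

theorem inv_zero (g : G) : R.total.inv ⟨β g, 0⟩ = ⟨β (𝒢.inv g), 0⟩ := by
  rw [R.total_inv, map_zero]

theorem unit_zero (x : M) : R.total.unit ⟨β₀ x, 0⟩ = ⟨β (𝒢.unit x), 0⟩ := by
  rw [R.total_unit, map_zero]

theorem mul_zero {g h : G} (hc : 𝒢.src g = 𝒢.tgt h) :
    R.total.mul ⟨β g, 0⟩ ⟨β h, 0⟩ = ⟨β (𝒢.mul g h), 0⟩ := by
  rw [R.total_mul g h hc, ← Prod.zero_eq_mk, map_zero]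
  rw [R.src_zero, R.tgt_zero, hc]

theorem div_zero {g h : G} (hc : 𝒢.src g = 𝒢.tgt h) :
    R.total.div ⟨β (𝒢.mul g h), 0⟩ ⟨β h, 0⟩ = ⟨β g, 0⟩ := by
  rw [← R.mul_zero hc, R.total.mul_div_cancel (by rw [R.src_zero, R.tgt_zero, hc])]

theorem src_of_src_eq_zero {g : G} {v : W (β g)} (hv : 𝒱.src g v = 0) :
    R.total.src ⟨β g, v⟩ = ⟨β₀ (𝒢.src g), 0⟩ := by
  rw [R.total_src, hv]

theorem tgt_of_tgt_eq_zero {g : G} {v : W (β g)} (hv : 𝒱.tgt g v = 0) :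
    R.total.tgt ⟨β g, v⟩ = ⟨β₀ (𝒢.tgt g), 0⟩ := by
  rw [R.total_tgt, hv]

theorem src_eq_zero_iff {g : G} {v : W (β g)} :
    𝒱.src g v = 0 ↔ R.total.src ⟨β g, v⟩ = ⟨β₀ (𝒢.src g), 0⟩ :=
  ⟨R.src_of_src_eq_zero, fun h => mk_inj F₀ ((R.total_src g v).symm.trans h)⟩

theorem tgt_eq_zero_iff {g : G} {v : W (β g)} :
    𝒱.tgt g v = 0 ↔ R.total.tgt ⟨β g, v⟩ = ⟨β₀ (𝒢.tgt g), 0⟩ :=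
  ⟨R.tgt_of_tgt_eq_zero, fun h => mk_inj F₀ ((R.total_tgt g v).symm.trans h)⟩

theorem src_core {x : M} {v : W (β (𝒢.unit x))} (hv : 𝒱.src (𝒢.unit x) v = 0) :
    R.total.src ⟨β (𝒢.unit x), v⟩ = ⟨β₀ x, 0⟩ := by
  rw [R.src_of_src_eq_zero hv, 𝒢.src_unit]

theorem comp_core_zero {g : G} {v : W (β (𝒢.unit (𝒢.tgt g)))}
    (hv : 𝒱.src (𝒢.unit (𝒢.tgt g)) v = 0) :
    R.total.src ⟨β (𝒢.unit (𝒢.tgt g)), v⟩ = R.total.tgt ⟨β g, 0⟩ := by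
  rw [R.src_core hv, R.tgt_zero]

theorem comp_zero_inv_core {g : G} {v : W (β (𝒢.unit (𝒢.src g)))}
    (hv : 𝒱.src (𝒢.unit (𝒢.src g)) v = 0) :
    R.total.src ⟨β g, 0⟩ = R.total.src ⟨β (𝒢.unit (𝒢.src g)), v⟩ := by
  rw [R.src_core hv, R.src_zero]

/-- Like `mk_lmulInv`, `mk_div` and `mk_act`, this translates a linear map into a groupoid product.
The side condition is composability: the linear `mul` has a meaning only on composable pairs. -/
theorem mk_rmul {g : G} {v : W (β (𝒢.unit (𝒢.tgt g)))} (hv : 𝒱.src (𝒢.unit (𝒢.tgt g)) v = 0) :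
    (⟨β g, 𝒱.rmul g v⟩ : TotalSpace F W) =
      R.total.mul ⟨β (𝒢.unit (𝒢.tgt g)), v⟩ ⟨β g, 0⟩ := by
  rw [R.total_mul _ _ (𝒢.src_unit _) _ _ (R.comp_core_zero hv)]
  exact mk_fibCast F W β (𝒢.unit_mul g) _

theorem mk_lmulInv {g : G} {v : W (β (𝒢.unit (𝒢.src g)))}
    (hv : 𝒱.src (𝒢.unit (𝒢.src g)) v = 0) :
    (⟨β g, 𝒱.lmulInv g v⟩ : TotalSpace F W) =
      R.total.div ⟨β g, 0⟩ ⟨β (𝒢.unit (𝒢.src g)), v⟩ := by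
  have h := R.comp_zero_inv_core hv
  rw [SmoothGroupoid.div, R.total_inv, R.total_mul _ _ (by rw [𝒢.tgt_inv, 𝒢.src_unit])]
  · exact mk_fibCast F W β (𝒢.mul_inv_unit g) _
  · rw [← R.total_inv, R.total.tgt_inv, h]

theorem mk_div {g h : G} (hc : 𝒢.src g = 𝒢.tgt h) {v : W (β (𝒢.mul g h))} {w : W (β h)}
    (e : R.total.src ⟨β (𝒢.mul g h), v⟩ = R.total.src ⟨β h, w⟩) :
    (⟨β g, 𝒱.div g h hc (v, w)⟩ : TotalSpace F W) =
      R.total.div ⟨β (𝒢.mul g h), v⟩ ⟨β h, w⟩ := by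
  rw [SmoothGroupoid.div, R.total_inv,
    R.total_mul _ _ ((𝒢.src_mul g h hc).trans (𝒢.tgt_inv h).symm)]
  · exact mk_fibCast F W β (𝒢.mul_mul_inv hc) _
  · rw [← R.total_inv, R.total.tgt_inv, e]

theorem comp_zero_mul_kernel {g : G} {v : W (β (𝒢.unit (𝒢.src g)))}
    (hv : v ∈ 𝒱.kfib (𝒢.src g)) :
    R.total.src ⟨β g, 0⟩ = R.total.tgt ⟨β (𝒢.unit (𝒢.src g)), v⟩ := by
  rw [R.src_zero, R.tgt_of_tgt_eq_zero hv.2, 𝒢.tgt_unit]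

theorem mk_act {g : G} {v : W (β (𝒢.unit (𝒢.src g)))} (hv : v ∈ 𝒱.kfib (𝒢.src g)) :
    (⟨β (𝒢.unit (𝒢.tgt g)), 𝒱.act g v⟩ : TotalSpace F W) =
      R.total.div (R.total.mul ⟨β g, 0⟩ ⟨β (𝒢.unit (𝒢.src g)), v⟩) ⟨β g, 0⟩ := by
  have h1 := R.comp_zero_mul_kernel hv
  have h2 : R.total.src (R.total.mul ⟨β g, 0⟩ ⟨β (𝒢.unit (𝒢.src g)), v⟩) =
      R.total.tgt (R.total.inv ⟨β g, 0⟩) := by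
    rw [R.total.src_mul _ _ h1, R.total.tgt_inv, ← R.comp_zero_inv_core hv.1]
  rw [R.total_mul _ _ (𝒢.tgt_unit _).symm _ _ h1, R.inv_zero] at h2
  rw [SmoothGroupoid.div, R.total_mul _ _ (𝒢.tgt_unit _).symm _ _ h1, R.inv_zero,
    R.total_mul _ _ (by rw [𝒢.mul_unit, 𝒢.tgt_inv]) _ _ h2]
  exact mk_fibCast F W β (𝒢.conj_unit g) _

theorem src_rmul {g : G} {v : W (β (𝒢.unit (𝒢.tgt g)))} (hv : 𝒱.src (𝒢.unit (𝒢.tgt g)) v = 0) :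
    𝒱.src g (𝒱.rmul g v) = 0 := by
  rw [R.src_eq_zero_iff, R.mk_rmul hv, R.total.src_mul _ _ (R.comp_core_zero hv), R.src_zero]

theorem total_tgt_rmul {g : G} {v : W (β (𝒢.unit (𝒢.tgt g)))}
    (hv : 𝒱.src (𝒢.unit (𝒢.tgt g)) v = 0) :
    R.total.tgt ⟨β g, 𝒱.rmul g v⟩ = R.total.tgt ⟨β (𝒢.unit (𝒢.tgt g)), v⟩ := by
  rw [R.mk_rmul hv, R.total.tgt_mul _ _ (R.comp_core_zero hv)]

theorem tgt_rmul {g : G} {v : W (β (𝒢.unit (𝒢.tgt g)))} (hv : 𝒱.src (𝒢.unit (𝒢.tgt g)) v = 0) :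
    𝒱.tgt g (𝒱.rmul g v) =
      fibCast (fun x => W₀ (β₀ x)) (𝒢.tgt_unit _) (𝒱.tgt (𝒢.unit (𝒢.tgt g)) v) := by
  apply mk_inj F₀
  rw [mk_fibCast F₀ W₀ β₀, ← R.total_tgt, ← R.total_tgt, R.total_tgt_rmul hv]

theorem src_lmulInv {g : G} {v : W (β (𝒢.unit (𝒢.src g)))}
    (hv : 𝒱.src (𝒢.unit (𝒢.src g)) v = 0) :
    𝒱.src g (𝒱.lmulInv g v) =
      fibCast (fun x => W₀ (β₀ x)) (𝒢.tgt_unit _) (𝒱.tgt (𝒢.unit (𝒢.src g)) v) := by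
  apply mk_inj F₀
  rw [mk_fibCast F₀ W₀ β₀, ← R.total_src, ← R.total_tgt, R.mk_lmulInv hv,
    R.total.src_div (R.comp_zero_inv_core hv)]

theorem tgt_lmulInv {g : G} {v : W (β (𝒢.unit (𝒢.src g)))}
    (hv : 𝒱.src (𝒢.unit (𝒢.src g)) v = 0) : 𝒱.tgt g (𝒱.lmulInv g v) = 0 := by
  rw [R.tgt_eq_zero_iff, R.mk_lmulInv hv, R.total.tgt_div (R.comp_zero_inv_core hv), R.tgt_zero]

theorem rmul_injOn {g : G} {v : W (β (𝒢.unit (𝒢.tgt g)))}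
    (hv : 𝒱.src (𝒢.unit (𝒢.tgt g)) v = 0) (h : 𝒱.rmul g v = 0) : v = 0 := by
  apply mk_inj F
  have hz : 𝒱.src (𝒢.unit (𝒢.tgt g)) 0 = 0 := map_zero _
  apply R.total.mul_right_cancel (R.comp_core_zero hv) (R.comp_core_zero hz)
  rw [← R.mk_rmul hv, ← R.mk_rmul hz, h, map_zero]

/-- Right translation by `0_g⁻¹` inverts `VBMaps.rmul`. -/
theorem exists_rmul_eq {g : G} {w : W (β g)} (hs : 𝒱.src g w = 0) (ht : 𝒱.tgt g w = 0) :
    ∃ v ∈ 𝒱.kfib (𝒢.tgt g), 𝒱.rmul g v = w ∧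
      (⟨β (𝒢.unit (𝒢.tgt g)), v⟩ : TotalSpace F W) = R.total.div ⟨β g, w⟩ ⟨β g, 0⟩ := by
  have h0 : R.total.src ⟨β g, w⟩ = R.total.src ⟨β g, 0⟩ := by
    rw [R.src_of_src_eq_zero hs, R.src_zero]
  have h1 : R.total.src ⟨β g, w⟩ = R.total.tgt ⟨β (𝒢.inv g), 0⟩ := by
    rw [h0, ← R.inv_zero, R.total.tgt_inv]
  -- The witness is `w · 0_{g⁻¹}`, moved to the fibre over `1_{t(g)}` along `g g⁻¹ = 1_{t(g)}`. The
  -- formula as a division is kept in the conclusion because smoothness of the inverse of `r` is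
  -- read off from it.
  have key : (⟨β (𝒢.unit (𝒢.tgt g)), fibCast (fun g => W (β g)) (𝒢.mul_inv g)
      (𝒱.mul g (𝒢.inv g) (𝒢.tgt_inv g).symm (w, 0))⟩ : TotalSpace F W) =
      R.total.div ⟨β g, w⟩ ⟨β g, 0⟩ := by
    rw [SmoothGroupoid.div, R.inv_zero, R.total_mul _ _ (𝒢.tgt_inv g).symm _ _ h1]
    exact mk_fibCast F W β _ _
  refine ⟨_, ⟨?_, ?_⟩, ?_, key⟩
  · rw [SetLike.mem_coe, LinearMap.mem_ker, R.src_eq_zero_iff, key, R.total.src_div h0, R.tgt_zero, 𝒢.src_unit]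
  · rw [SetLike.mem_coe, LinearMap.mem_ker, R.tgt_eq_zero_iff, key, R.total.tgt_div h0, R.tgt_of_tgt_eq_zero ht,
      𝒢.tgt_unit]
  · apply mk_inj F
    rw [R.mk_rmul, key, R.total.div_mul_cancel h0]
    rw [R.src_eq_zero_iff, key, R.total.src_div h0, R.tgt_zero, 𝒢.src_unit]

/-- An Eckmann–Hilton argument: vectors of `𝔨_x` have source and target zero, so `(-v, 0)` and `(0,
v)` are both composable, with products `-v` and `v`. Linearity gives `(-v) · v = -v + v = 0`, and
`0` is the unit over `0_x`. -/
theorem inv_kernel {x : M} {v : W (β (𝒢.unit x))} (hv : v ∈ 𝒱.kfib x) :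
    (⟨β (𝒢.unit x), -v⟩ : TotalSpace F W) = R.total.inv ⟨β (𝒢.unit x), v⟩ := by
  have hs := R.src_of_src_eq_zero hv.1
  have ht := R.tgt_of_tgt_eq_zero hv.2
  rw [𝒢.src_unit] at hs
  rw [𝒢.tgt_unit] at ht
  have hs' := R.src_of_src_eq_zero ((𝒱.kfib x).neg_mem hv).1
  have ht' := R.tgt_of_tgt_eq_zero ((𝒱.kfib x).neg_mem hv).2
  rw [𝒢.src_unit] at hs'
  rw [𝒢.tgt_unit] at ht'
  have hz := R.unit_zero x
  have hzs := R.src_zero (𝒢.unit x)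
  have hzt := R.tgt_zero (𝒢.unit x)
  rw [𝒢.src_unit] at hzs
  rw [𝒢.tgt_unit] at hzt
  have hc : 𝒢.src (𝒢.unit x) = 𝒢.tgt (𝒢.unit x) := by rw [𝒢.src_unit, 𝒢.tgt_unit]
  have hu : 𝒢.mul (𝒢.unit x) (𝒢.unit x) = 𝒢.unit x := by
    have := 𝒢.mul_unit (𝒢.unit x); rwa [𝒢.src_unit] at this
  have e1 : ∀ {w : W (β (𝒢.unit x))}, w ∈ 𝒱.kfib x →
      fibCast (fun g => W (β g)) hu (𝒱.mul _ _ hc (w, 0)) = w := by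
    intro w hw
    have hs := R.src_of_src_eq_zero hw.1
    rw [𝒢.src_unit] at hs
    apply mk_inj F
    rw [mk_fibCast F W β, ← R.total_mul _ _ hc _ _ (by rw [hs, hzt]), ← hz, ← hs,
      R.total.mul_unit]
  have e2 : ∀ {w : W (β (𝒢.unit x))}, w ∈ 𝒱.kfib x →
      fibCast (fun g => W (β g)) hu (𝒱.mul _ _ hc (0, w)) = w := by
    intro w hw
    have ht := R.tgt_of_tgt_eq_zero hw.2
    rw [𝒢.tgt_unit] at ht
    apply mk_inj F
    rw [mk_fibCast F W β, ← R.total_mul _ _ hc _ _ (by rw [ht, hzs]), ← hz, ← ht,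
      R.total.unit_mul]
  have e3 : fibCast (fun g => W (β g)) hu (𝒱.mul _ _ hc (-v, v)) = 0 := by
    have : ((-v, v) : W (β (𝒢.unit x)) × W (β (𝒢.unit x))) = (-v, 0) + (0, v) := by simp
    rw [this, map_add, map_add, e1 ((𝒱.kfib x).neg_mem hv), e2 hv, neg_add_cancel]
  have e4 : R.total.mul ⟨β (𝒢.unit x), -v⟩ ⟨β (𝒢.unit x), v⟩ = ⟨β (𝒢.unit x), 0⟩ := by
    rw [R.total_mul _ _ hc _ _ (by rw [hs', ht]), ← mk_fibCast F W β hu, e3]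
  apply R.total.mul_right_cancel (h := ⟨β (𝒢.unit x), v⟩)
  · rw [hs', ht]
  · rw [R.total.src_inv]
  · rw [e4, R.total.inv_mul, hs, hz]

/-- On the kernel, `0_g · v⁻¹ = -(g · v) · 0_g`. -/
theorem lmulInv_kernel {g : G} {v : W (β (𝒢.unit (𝒢.src g)))} (hv : v ∈ 𝒱.kfib (𝒢.src g)) :
    𝒱.lmulInv g v = - 𝒱.rmul g (𝒱.act g v) := by
  have hn := (𝒱.kfib _).neg_mem hv
  rw [← map_neg, ← map_neg]
  have h0 := R.comp_zero_mul_kernel hn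
  have h1 : R.total.src (R.total.mul ⟨β g, 0⟩ ⟨β (𝒢.unit (𝒢.src g)), -v⟩) =
      R.total.src ⟨β g, 0⟩ := by
    rw [R.total.src_mul _ _ h0, ← R.comp_zero_inv_core hn.1]
  have ha : 𝒱.src _ (𝒱.act g (-v)) = 0 := by
    rw [R.src_eq_zero_iff, R.mk_act hn, R.total.src_div h1, R.tgt_zero, 𝒢.src_unit]
  apply mk_inj F
  rw [R.mk_lmulInv hv.1, R.mk_rmul ha, R.mk_act hn, R.total.div_mul_cancel h1, R.inv_kernel hv]
  rfl

theorem act_mem {g : G} {v : W (β (𝒢.unit (𝒢.src g)))} (hv : v ∈ 𝒱.kfib (𝒢.src g)) :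
    𝒱.act g v ∈ 𝒱.kfib (𝒢.tgt g) := by
  have h0 := R.comp_zero_mul_kernel hv
  have h1 : R.total.src (R.total.mul ⟨β g, 0⟩ ⟨β (𝒢.unit (𝒢.src g)), v⟩) =
      R.total.src ⟨β g, 0⟩ := by
    rw [R.total.src_mul _ _ h0, ← R.comp_zero_inv_core hv.1]
  constructor
  · rw [SetLike.mem_coe, LinearMap.mem_ker, R.src_eq_zero_iff, R.mk_act hv, R.total.src_div h1, R.tgt_zero,
      𝒢.src_unit]
  · rw [SetLike.mem_coe, LinearMap.mem_ker, R.tgt_eq_zero_iff, R.mk_act hv, R.total.tgt_div h1,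
      R.total.tgt_mul _ _ h0, R.tgt_zero, 𝒢.tgt_unit]

/-- In the total groupoid, `a · 0_{gh} · 0_h⁻¹ = a · 0_g`. -/
theorem div_rmul_left {g h : G} (hc : 𝒢.src g = 𝒢.tgt h)
    {a : W (β (𝒢.unit (𝒢.tgt (𝒢.mul g h))))} (ha : 𝒱.src _ a = 0) :
    𝒱.div g h hc (𝒱.rmul (𝒢.mul g h) a, 0) =
      𝒱.rmul g (fibCast (fun x => W (β (𝒢.unit x))) (𝒢.tgt_mul g h hc) a) := by
  have ha' : 𝒱.src _ (fibCast (fun x => W (β (𝒢.unit x))) (𝒢.tgt_mul g h hc) a) = 0 := by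
    rw [R.src_eq_zero_iff, mk_fibCast F W (fun x => β (𝒢.unit x)), R.src_core ha, 𝒢.src_unit,
      𝒢.tgt_mul g h hc]
  apply mk_inj F
  have h0 : R.total.src ⟨β (𝒢.mul g h), 0⟩ = R.total.src ⟨β h, 0⟩ := by
    rw [R.src_zero, R.src_zero, 𝒢.src_mul _ _ hc]
  have h1 := R.comp_core_zero ha
  rw [R.mk_div, R.mk_rmul ha', R.mk_rmul ha, R.total.mul_div_assoc h1 h0, R.div_zero hc,
    mk_fibCast F W (fun x => β (𝒢.unit x))]
  rw [R.mk_rmul ha, R.total.src_mul _ _ h1, h0]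

/-- In the total groupoid, `0_{gh} (b · 0_h)⁻¹ = (0_g · 0_h)(b · 0_h)⁻¹ = 0_g · b⁻¹`. -/
theorem div_rmul_right {g h : G} (hc : 𝒢.src g = 𝒢.tgt h)
    {b : W (β (𝒢.unit (𝒢.tgt h)))} (hb : 𝒱.src _ b = 0) :
    𝒱.div g h hc (0, 𝒱.rmul h b) =
      𝒱.lmulInv g (fibCast (fun x => W (β (𝒢.unit x))) hc.symm b) := by
  have hb' : 𝒱.src _ (fibCast (fun x => W (β (𝒢.unit x))) hc.symm b) = 0 := by
    rw [R.src_eq_zero_iff, mk_fibCast F W (fun x => β (𝒢.unit x)), R.src_core hb, 𝒢.src_unit, hc]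
  apply mk_inj F
  have h1 := R.comp_core_zero hb
  have h2 : R.total.src ⟨β g, 0⟩ = R.total.tgt ⟨β h, 0⟩ := by
    rw [R.src_zero, R.tgt_zero, hc]
  rw [R.mk_div, R.mk_lmulInv hb', R.mk_rmul hb, ← R.mul_zero hc, R.total.mul_div_mul h2 h1,
    mk_fibCast F W (fun x => β (𝒢.unit x))]
  rw [R.src_zero, R.src_of_src_eq_zero (R.src_rmul hb), 𝒢.src_mul _ _ hc]

/-- Here `a` and `b` are the same vector, so it cancels: `(0_{gh} · a⁻¹)(0_h · a⁻¹)⁻¹ = 0_{gh} ·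
0_h⁻¹ = 0_g`. -/
theorem div_lmulInv {g h : G} (hc : 𝒢.src g = 𝒢.tgt h)
    {a : W (β (𝒢.unit (𝒢.src (𝒢.mul g h))))} (ha : 𝒱.src _ a = 0)
    {b : W (β (𝒢.unit (𝒢.src h)))}
    (hab : fibCast (fun x => W (β (𝒢.unit x))) (𝒢.src_mul g h hc) a = b) :
    𝒱.div g h hc (𝒱.lmulInv (𝒢.mul g h) a, 𝒱.lmulInv h b) = 0 := by
  have e : (⟨_, a⟩ : TotalSpace F W) = ⟨β (𝒢.unit (𝒢.src h)), b⟩ := by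
    rw [← hab, mk_fibCast F W (fun x => β (𝒢.unit x))]
  have hb : 𝒱.src _ b = 0 := by
    rw [R.src_eq_zero_iff, ← e, R.src_core ha, 𝒢.src_unit, 𝒢.src_mul _ _ hc]
  have h1 := R.comp_zero_inv_core ha
  have h2 := R.comp_zero_inv_core hb
  apply mk_inj F
  rw [R.mk_div, R.mk_lmulInv ha, R.mk_lmulInv hb, e, R.total.div_div_div (by rw [h1, e]) h2,
    R.div_zero hc]
  rw [R.mk_lmulInv ha, R.mk_lmulInv hb, R.total.src_div h1, R.total.src_div h2, e]

end VBMaps.Realization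

theorem VBMaps.fibCast_kernel (𝒱 : VBMaps 𝒢 K β F W K₀ β₀ F₀ W₀) {x y : M} (h : x = y) {v : W (β (𝒢.unit x))} (hv : v ∈ 𝒱.kfib x) :
    fibCast (fun x => W (β (𝒢.unit x))) h v ∈ 𝒱.kfib y := by
  subst h; exact hv

/-! ### Differentials and lifts -/

namespace VBMaps.Realization

variable {𝒱 : VBMaps 𝒢 K β F W K₀ β₀ F₀ W₀} (R : 𝒱.Realization)

include R

theorem src_div {g h : G} (hc : 𝒢.src g = 𝒢.tgt h) {v : W (β (𝒢.mul g h))} {w : W (β h)}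
    (e : R.total.src ⟨β (𝒢.mul g h), v⟩ = R.total.src ⟨β h, w⟩) :
    𝒱.src g (𝒱.div g h hc (v, w)) = fibCast (fun x => W₀ (β₀ x)) hc.symm (𝒱.tgt h w) := by
  apply mk_inj F₀
  rw [mk_fibCast F₀ W₀ β₀, ← R.total_src, ← R.total_tgt, R.mk_div hc e, R.total.src_div e]

theorem tgt_div {g h : G} (hc : 𝒢.src g = 𝒢.tgt h) {v : W (β (𝒢.mul g h))} {w : W (β h)}
    (e : R.total.src ⟨β (𝒢.mul g h), v⟩ = R.total.src ⟨β h, w⟩) :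
    𝒱.tgt g (𝒱.div g h hc (v, w)) =
      fibCast (fun x => W₀ (β₀ x)) (𝒢.tgt_mul g h hc) (𝒱.tgt (𝒢.mul g h) v) := by
  apply mk_inj F₀
  rw [mk_fibCast F₀ W₀ β₀, ← R.total_tgt, ← R.total_tgt, R.mk_div hc e, R.total.tgt_div e]

/-- By linearity the pair splits into `(a · 0_{gh}, 0)` and `(0, b · 0_h)`, which contribute `a ·
0_g` and `0_g · b⁻¹ = -(g · b) · 0_g`. This converts the division term of the VB-differential into
the first two terms of the differential on `𝔨`, in degrees 1 and 2 alike. -/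
theorem neg_div_rmul_add_rmul {g h : G} (hc : 𝒢.src g = 𝒢.tgt h)
    {a : W (β (𝒢.unit (𝒢.tgt (𝒢.mul g h))))} (ha : a ∈ 𝒱.kfib _)
    {b : W (β (𝒢.unit (𝒢.tgt h)))} (hb : b ∈ 𝒱.kfib _) :
    - 𝒱.div g h hc (𝒱.rmul (𝒢.mul g h) a, 𝒱.rmul h b) =
      𝒱.rmul g (𝒱.act g (fibCast (fun x => W (β (𝒢.unit x))) hc.symm b) -
        fibCast (fun x => W (β (𝒢.unit x))) (𝒢.tgt_mul g h hc) a) := by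
  have e : (𝒱.rmul (𝒢.mul g h) a, 𝒱.rmul h b) =
      (𝒱.rmul (𝒢.mul g h) a, (0 : W (β h))) + ((0 : W (β (𝒢.mul g h))), 𝒱.rmul h b) := by simp
  rw [e, map_add, R.div_rmul_left hc ha.1, R.div_rmul_right hc hb.1,
    R.lmulInv_kernel (𝒱.fibCast_kernel hc.symm hb), map_sub]
  abel

theorem d1_r1 {e : ∀ g, W (β (𝒢.unit (𝒢.tgt g)))} (he : ∀ g, e g ∈ 𝒱.kfib (𝒢.tgt g)) :
    𝒱.d1 (𝒱.r1 e) = 𝒱.r2 (𝒱.kd1 e) := by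
  funext p
  change - 𝒱.div p.1.1 p.1.2 p.2 (𝒱.rmul _ _, 𝒱.rmul _ _) + 𝒱.rmul _ _ = 𝒱.rmul p.1.1 (_ + _)
  rw [R.neg_div_rmul_add_rmul p.2 (he _) (he _), map_add]

theorem d2_r2 {e : ∀ p : 𝒢.Comp2, W (β (𝒢.unit (𝒢.tgt p.1.1)))}
    (he : ∀ p, e p ∈ 𝒱.kfib (𝒢.tgt p.1.1)) (p : 𝒢.Comp3) :
    𝒱.d2 (𝒱.r2 e) p = 𝒱.rmul p.1.1 (𝒱.kd2 e p) := by
  change - 𝒱.div p.1.1 p.1.2.1 p.2.1 (𝒱.rmul _ _, 𝒱.rmul _ _) + 𝒱.rmul _ _ - 𝒱.rmul _ _ =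
    𝒱.rmul p.1.1 (_ + _ - _)
  rw [R.neg_div_rmul_add_rmul p.2.1 (he (LieGroupoid.face1 p)) (he (LieGroupoid.face0 p))]
  simp only [map_sub, map_add]

theorem kd2_mem {e : ∀ p : 𝒢.Comp2, W (β (𝒢.unit (𝒢.tgt p.1.1)))}
    (he : ∀ p, e p ∈ 𝒱.kfib (𝒢.tgt p.1.1)) (p : 𝒢.Comp3) :
    𝒱.kd2 e p ∈ 𝒱.kfib (𝒢.tgt p.1.1) := by
  have h1 := R.act_mem (𝒱.fibCast_kernel p.2.1.symm (he (LieGroupoid.face0 p)))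
  have h2 := 𝒱.fibCast_kernel (𝒢.tgt_mul _ _ p.2.1) (he (LieGroupoid.face1 p))
  exact sub_mem (add_mem (sub_mem h1 h2) (he (LieGroupoid.face2 p))) (he (LieGroupoid.face3 p))

theorem kd1_mem {e : ∀ g, W (β (𝒢.unit (𝒢.tgt g)))} (he : ∀ g, e g ∈ 𝒱.kfib (𝒢.tgt g))
    (p : 𝒢.Comp2) : 𝒱.kd1 e p ∈ 𝒱.kfib (𝒢.tgt p.1.1) := by
  have h1 := R.act_mem (𝒱.fibCast_kernel p.2.symm (he p.1.2))
  have h2 := 𝒱.fibCast_kernel (𝒢.tgt_mul _ _ p.2) (he (𝒢.mul p.1.1 p.1.2))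
  exact add_mem (sub_mem h1 h2) (he p.1.1)

theorem kd0_mem {α : ∀ x, W (β (𝒢.unit x))} (hα : ∀ x, α x ∈ 𝒱.kfib x) (g : G) :
    𝒱.kd0 α g ∈ 𝒱.kfib (𝒢.tgt g) :=
  sub_mem (R.act_mem (hα _)) (hα _)

/-- The sign comes from the conventions for the two differentials in degree 0. It does not affect
coboundary spaces, but it explains the witnesses `-α` in the comparison of degree 1 cohomology. -/
theorem d0_eq_neg_r1 {α : ∀ x, W (β (𝒢.unit x))} (hα : ∀ x, α x ∈ 𝒱.kfib x) (g : G) :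
    𝒱.d0 α g = - 𝒱.r1 (𝒱.kd0 α) g := by
  change 𝒱.rmul g _ + 𝒱.lmulInv g _ = - 𝒱.rmul g (_ - _)
  rw [R.lmulInv_kernel (hα _), map_sub]
  abel

/-- The term `α_{t(g)} · 0_g` has source zero and target `∂α`, while `0_g · α_{s(g)}⁻¹` has target
zero and source `∂α`. -/
theorem isLift_d0 {α : ∀ x, W (β (𝒢.unit x))} (hα : ∀ x, 𝒱.src _ (α x) = 0) :
    𝒱.IsLift (𝒱.d0 α) (𝒱.anchor α) := by
  intro g
  constructor
  · change 𝒱.src g (𝒱.rmul g _ + 𝒱.lmulInv g _) = _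
    rw [map_add, R.src_rmul (hα _), R.src_lmulInv (hα _), zero_add]
    rfl
  · change 𝒱.tgt g (𝒱.rmul g _ + 𝒱.lmulInv g _) = _
    rw [map_add, R.tgt_rmul (hα _), R.tgt_lmulInv (hα _), add_zero]
    rfl

theorem d1_d0 {α : ∀ x, W (β (𝒢.unit x))} (hα : ∀ x, 𝒱.src _ (α x) = 0) :
    𝒱.d1 (𝒱.d0 α) = 0 := by
  funext p
  obtain ⟨⟨g, h⟩, hc : 𝒢.src g = 𝒢.tgt h⟩ := p
  change - 𝒱.div g h hc (𝒱.rmul _ (α _) + 𝒱.lmulInv _ (α _), 𝒱.rmul _ (α _) + 𝒱.lmulInv _ (α _)) +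
    (𝒱.rmul g (α _) + 𝒱.lmulInv g (α _)) = 0
  -- The two `rmul` terms can be divided separately, having source zero. The two `lmulInv` terms
  -- must stay together, since only their common source `∂α` makes the division meaningful.
  have e : (𝒱.rmul (𝒢.mul g h) (α (𝒢.tgt (𝒢.mul g h))) +
        𝒱.lmulInv (𝒢.mul g h) (α (𝒢.src (𝒢.mul g h))),
      𝒱.rmul h (α (𝒢.tgt h)) + 𝒱.lmulInv h (α (𝒢.src h))) =
      (𝒱.rmul (𝒢.mul g h) (α _), (0 : W (β h))) + ((0 : W (β (𝒢.mul g h))), 𝒱.rmul h (α _)) +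
      (𝒱.lmulInv (𝒢.mul g h) (α _), 𝒱.lmulInv h (α _)) := by simp
  rw [e, map_add, map_add, R.div_rmul_left hc (hα _), R.div_rmul_right hc (hα _),
    R.div_lmulInv hc (hα _) (fibCast_section (A := fun x => W (β (𝒢.unit x))) α _),
    fibCast_section (A := fun x => W (β (𝒢.unit x))) α,
    fibCast_section (A := fun x => W (β (𝒢.unit x))) α]
  abel

theorem src_mul_eq_of_projectable {X : ∀ g, W (β g)} {σ : ∀ x, W₀ (β₀ x)}
    (hX : ∀ g, 𝒱.src g (X g) = σ (𝒢.src g)) {g h : G} (hc : 𝒢.src g = 𝒢.tgt h) :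
    R.total.src ⟨β (𝒢.mul g h), X (𝒢.mul g h)⟩ = R.total.src ⟨β h, X h⟩ := by
  rw [R.total_src, R.total_src, hX, hX, 𝒢.src_mul _ _ hc]

theorem d2_d1 {X : ∀ g, W (β g)} {σ : ∀ x, W₀ (β₀ x)}
    (hX : ∀ g, 𝒱.src g (X g) = σ (𝒢.src g)) : 𝒱.d2 (𝒱.d1 X) = 0 := by
  funext p
  obtain ⟨⟨g, h, k⟩, hc : 𝒢.src g = 𝒢.tgt h, hd : 𝒢.src h = 𝒢.tgt k⟩ := p
  have hm : 𝒢.src (𝒢.mul g h) = 𝒢.tgt k := (𝒢.src_mul _ _ hc).trans hd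
  have hm' : 𝒢.src g = 𝒢.tgt (𝒢.mul h k) := hc.trans (𝒢.tgt_mul _ _ hd).symm
  change - 𝒱.div g h hc
      (- 𝒱.div (𝒢.mul g h) k hm (X _, X k) + X _, - 𝒱.div h k hd (X (𝒢.mul h k), X k) + X h) +
      (- 𝒱.div g (𝒢.mul h k) hm' (X _, X _) + X g) - (- 𝒱.div g h hc (X _, X _) + X g) = 0
  have e : ((- 𝒱.div (𝒢.mul g h) k hm (X (𝒢.mul (𝒢.mul g h) k), X k) + X (𝒢.mul g h),
      - 𝒱.div h k hd (X (𝒢.mul h k), X k) + X h) : W (β (𝒢.mul g h)) × W (β h)) =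
      - (𝒱.div (𝒢.mul g h) k hm (X (𝒢.mul (𝒢.mul g h) k), X k),
        𝒱.div h k hd (X (𝒢.mul h k), X k)) + (X (𝒢.mul g h), X h) := by simp
  have c1 := R.src_mul_eq_of_projectable hX hm
  have c2 := R.src_mul_eq_of_projectable hX hd
  have c3 := R.src_mul_eq_of_projectable hX hm'
  -- This is `(X_{ghk} X_k⁻¹)(X_{hk} X_k⁻¹)⁻¹ = X_{ghk} X_{hk}⁻¹`; projectability of `X` supplies
  -- the equalities of sources.
  have key : 𝒱.div g h hc (𝒱.div (𝒢.mul g h) k hm (X (𝒢.mul (𝒢.mul g h) k), X k),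
      𝒱.div h k hd (X (𝒢.mul h k), X k)) =
      𝒱.div g (𝒢.mul h k) hm' (X (𝒢.mul g (𝒢.mul h k)), X (𝒢.mul h k)) := by
    apply mk_inj F
    rw [R.mk_div hc, R.mk_div hm c1, R.mk_div hd c2, R.mk_div hm' c3, R.total.div_div_div c1 c2,
      𝒢.mul_assoc g h k hc hd]
    rw [R.mk_div hm c1, R.mk_div hd c2, R.total.src_div c1, R.total.src_div c2]
  rw [e, map_add, map_neg, key]
  abel

theorem src_d1 {X : ∀ g, W (β g)} {σ : ∀ x, W₀ (β₀ x)}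
    (hX : ∀ g, 𝒱.src g (X g) = σ (𝒢.src g)) {g h : G} (hc : 𝒢.src g = 𝒢.tgt h) :
    𝒱.src g (𝒱.d1 X ⟨(g, h), hc⟩) =
      - fibCast (fun x => W₀ (β₀ x)) hc.symm (𝒱.tgt h (X h)) + σ (𝒢.src g) := by
  change 𝒱.src g (- 𝒱.div g h hc (X _, X _) + X g) = _
  rw [map_add, map_neg, R.src_div hc (R.src_mul_eq_of_projectable hX hc), hX]

theorem isLift_iff_src_d1_eq_zero {X : ∀ g, W (β g)} {σ : ∀ x, W₀ (β₀ x)}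
    (hX : ∀ g, 𝒱.src g (X g) = σ (𝒢.src g)) :
    𝒱.IsLift X σ ↔ ∀ p : 𝒢.Comp2, 𝒱.src p.1.1 (𝒱.d1 X p) = 0 := by
  constructor
  · rintro h ⟨⟨g, h'⟩, hc : 𝒢.src g = 𝒢.tgt h'⟩
    rw [R.src_d1 hX hc, (h h').2, fibCast_section (A := fun x => W₀ (β₀ x)) σ, neg_add_cancel]
  · intro h g
    refine ⟨hX g, ?_⟩
    have hc : 𝒢.src (𝒢.unit (𝒢.tgt g)) = 𝒢.tgt g := 𝒢.src_unit _
    -- The pair `(1_{t(g)}, g)` isolates the target of `X_g`: there the source of `δX` is `σ(t(g)) -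
    -- t(X_g)`.
    have e := h ⟨(𝒢.unit (𝒢.tgt g), g), hc⟩
    rw [R.src_d1 hX hc, neg_add_eq_zero, ← fibCast_section (A := fun x => W₀ (β₀ x)) σ hc.symm] at e
    apply mk_inj F₀
    rw [← mk_fibCast F₀ W₀ β₀ hc.symm, e, mk_fibCast F₀ W₀ β₀]

theorem tgt_d1 {X : ∀ g, W (β g)} {σ : ∀ x, W₀ (β₀ x)} (hX : 𝒱.IsLift X σ) (p : 𝒢.Comp2) :
    𝒱.tgt p.1.1 (𝒱.d1 X p) = 0 := by
  obtain ⟨⟨g, h⟩, hc : 𝒢.src g = 𝒢.tgt h⟩ := p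
  change 𝒱.tgt g (- 𝒱.div g h hc (X _, X _) + X g) = _
  rw [map_add, map_neg, R.tgt_div hc (R.src_mul_eq_of_projectable (fun g => (hX g).1) hc),
    (hX _).2, (hX _).2, fibCast_section (A := fun x => W₀ (β₀ x)) σ, neg_add_cancel]

end VBMaps.Realization

/-! ### Smoothness of the cochains -/

/-- This removes the extension by zero: products in the total groupoid are defined off `S` as well,
with meaningless values and over other base points, and only their restriction to `S` matters. -/
theorem mem_smoothSectionsOn_iff {EP HP : Type*} [NormedAddCommGroup EP] [NormedSpace ℝ EP]
    [TopologicalSpace HP] {IP : ModelWithCorners ℝ EP HP} {P : Type*} [TopologicalSpace P]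
    [ChartedSpace HP P] {S : Set P} {b : P → Q} {hb : ContMDiff IP K ∞ b} {c : ∀ p : S, W (b p)} :
    c ∈ smoothSectionsOn IP K F W S b hb ↔ ∃ f : P → TotalSpace F W,
      ContMDiffOn IP (K.prod 𝓘(ℝ, F)) ∞ f S ∧ ∀ p : S, f p = ⟨b p, c p⟩ := by
  classical
  constructor
  · intro h
    exact ⟨_, h, fun p => by rw [dif_pos p.2]⟩
  · rintro ⟨f, hf, hfc⟩
    refine hf.congr fun p hp => ?_
    rw [dif_pos hp, hfc ⟨p, hp⟩]

theorem contMDiff_zero_along {EP HP : Type*} [NormedAddCommGroup EP] [NormedSpace ℝ EP]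
    [TopologicalSpace HP] {IP : ModelWithCorners ℝ EP HP} {P : Type*} [TopologicalSpace P]
    [ChartedSpace HP P] {b : P → Q} (hb : ContMDiff IP K ∞ b) :
    ContMDiff IP (K.prod 𝓘(ℝ, F)) ∞ (fun p => (⟨b p, 0⟩ : TotalSpace F W)) :=
  fun x => contMDiffWithinAt_zero_along (hb x)

namespace VBMaps.Realization

variable {𝒱 : VBMaps 𝒢 K β F W K₀ β₀ F₀ W₀} (R : 𝒱.Realization)

include R

theorem r1_mem_sections {e : ∀ g, W (β (𝒢.unit (𝒢.tgt g)))} (he : e ∈ 𝒱.kC1) :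
    𝒱.r1 e ∈ 𝒱.sections := by
  have hk : ∀ g, e g ∈ 𝒱.kfib (𝒢.tgt g) := fun g => he.2 g trivial
  have h := R.total.contMDiffOn_mul (contMDiffOn_univ.2 he.1)
    (contMDiff_zero_along (F := F) (W := W) 𝒱.smooth_β).contMDiffOn
    fun g _ => R.comp_core_zero (hk g).1
  exact (contMDiffOn_univ.1 h).congr fun g => R.mk_rmul (hk g).1

theorem exists_r1_eq {X : ∀ g, W (β g)} (hX : X ∈ 𝒱.sections) (hs : ∀ g, 𝒱.src g (X g) = 0)
    (ht : ∀ g, 𝒱.tgt g (X g) = 0) : ∃ e ∈ 𝒱.kC1, 𝒱.r1 e = X := by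
  choose e he hr hd using fun g => R.exists_rmul_eq (hs g) (ht g)
  refine ⟨e, ⟨?_, fun g _ => he g⟩, funext hr⟩
  have h := R.total.contMDiffOn_div (contMDiffOn_univ.2 hX)
    (contMDiff_zero_along (F := F) (W := W) 𝒱.smooth_β).contMDiffOn
    fun g _ => by rw [R.src_of_src_eq_zero (hs g), R.src_zero]
  exact (contMDiffOn_univ.1 h).congr hd

theorem r2_mem_C2 {e : ∀ p : 𝒢.Comp2, W (β (𝒢.unit (𝒢.tgt p.1.1)))} (he : e ∈ 𝒱.kC2) :
    𝒱.r2 e ∈ 𝒱.C2 := by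
  have hk : ∀ p, e p ∈ 𝒱.kfib (𝒢.tgt p.1.1) := fun p => he.2 p trivial
  refine ⟨?_, 0, fun p => ?_⟩
  · obtain ⟨f, hf, hfe⟩ := mem_smoothSectionsOn_iff.1 he.1
    refine mem_smoothSectionsOn_iff.2 ⟨_, R.total.contMDiffOn_mul hf
      (contMDiff_zero_along (F := F) (W := W) (𝒱.smooth_β.comp contMDiff_fst)).contMDiffOn
      fun p hp => ?_, fun p => ?_⟩
    · rw [hfe ⟨p, hp⟩]
      exact R.comp_core_zero (hk ⟨p, hp⟩).1
    · rw [hfe p]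
      exact (R.mk_rmul (hk p).1).symm
  · exact (congrArg _ (R.src_rmul (hk p).1)).trans (map_zero _)

theorem exists_r2_eq {c : ∀ p : 𝒢.Comp2, W (β p.1.1)} (hc : c ∈ 𝒱.C2)
    (hs : ∀ p : 𝒢.Comp2, 𝒱.src p.1.1 (c p) = 0) (ht : ∀ p : 𝒢.Comp2, 𝒱.tgt p.1.1 (c p) = 0) :
    ∃ e ∈ 𝒱.kC2, 𝒱.r2 e = c := by
  choose e he hr hd using fun p => R.exists_rmul_eq (hs p) (ht p)
  refine ⟨e, ⟨?_, fun p _ => he p⟩, funext hr⟩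
  obtain ⟨f, hf, hfc⟩ := mem_smoothSectionsOn_iff.1 hc.1
  refine mem_smoothSectionsOn_iff.2 ⟨_, R.total.contMDiffOn_div hf
    (contMDiff_zero_along (F := F) (W := W) (𝒱.smooth_β.comp contMDiff_fst)).contMDiffOn
    fun p hp => ?_, fun p => ?_⟩
  · rw [hfc ⟨p, hp⟩]
    exact (R.src_of_src_eq_zero (hs ⟨p, hp⟩)).trans (R.src_zero _).symm
  · rw [hfc p]
    exact (hd p).symm

theorem d0_mem_C1 {α : ∀ x, W (β (𝒢.unit x))} (hα : α ∈ 𝒱.C0) : 𝒱.d0 α ∈ 𝒱.C1 := by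
  have hk : ∀ x, 𝒱.src _ (α x) = 0 := fun x => hα.2 x trivial
  refine ⟨fun x => ?_, 𝒱.anchor α, fun g => (R.isLift_d0 hk g).1⟩
  have z := (contMDiff_zero_along (F := F) (W := W) 𝒱.smooth_β).contMDiffOn (s := Set.univ)
  have h1 := R.total.contMDiffOn_mul (contMDiffOn_univ.2 (ContMDiff.comp hα.1 𝒢.smooth_tgt)) z
    fun g _ => R.comp_core_zero (hk (𝒢.tgt g))
  have h2 := R.total.contMDiffOn_div z (contMDiffOn_univ.2 (ContMDiff.comp hα.1 𝒢.smooth_src))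
    fun g _ => R.comp_zero_inv_core (hk (𝒢.src g))
  have h1' := (contMDiffOn_univ.1 h1).congr
    (f₁ := fun g => (⟨β g, 𝒱.rmul g (α (𝒢.tgt g))⟩ : TotalSpace F W)) fun g => R.mk_rmul (hk _)
  have h2' := (contMDiffOn_univ.1 h2).congr
    (f₁ := fun g => (⟨β g, 𝒱.lmulInv g (α (𝒢.src g))⟩ : TotalSpace F W)) fun g => R.mk_lmulInv (hk _)
  have h := contMDiffWithinAt_smul_add_along 1 (h1' x) (h2' x)
  simp only [one_smul] at h
  exact h

theorem d1_mem_smoothSectionsOn {X : ∀ g, W (β g)} (hX : X ∈ 𝒱.sections) {σ : ∀ x, W₀ (β₀ x)}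
    (hσ : ∀ g, 𝒱.src g (X g) = σ (𝒢.src g)) :
    𝒱.d1 X ∈ smoothSectionsOn (I.prod I) K F W 𝒢.Comp2 (fun p => β p.1)
      (𝒱.smooth_β.comp contMDiff_fst) := by
  have h1 : (fun p : 𝒢.Comp2 => 𝒱.div p.1.1 p.1.2 p.2 (X (𝒢.mul p.1.1 p.1.2), X p.1.2)) ∈
      smoothSectionsOn (I.prod I) K F W 𝒢.Comp2 (fun p => β p.1)
      (𝒱.smooth_β.comp contMDiff_fst) := by
    refine mem_smoothSectionsOn_iff.2 ⟨_, R.total.contMDiffOn_div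
      (ContMDiff.comp_contMDiffOn hX 𝒢.smooth_mul)
      (ContMDiff.comp hX contMDiff_snd).contMDiffOn fun p hp => ?_, fun p => ?_⟩
    · exact R.src_mul_eq_of_projectable hσ hp
    · exact (R.mk_div p.2 (R.src_mul_eq_of_projectable hσ p.2)).symm
  have h2 : (fun p : 𝒢.Comp2 => X p.1.1) ∈
      smoothSectionsOn (I.prod I) K F W 𝒢.Comp2 (fun p => β p.1)
      (𝒱.smooth_β.comp contMDiff_fst) :=
    mem_smoothSectionsOn_iff.2 ⟨_, (ContMDiff.comp hX contMDiff_fst).contMDiffOn, fun p => rfl⟩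
  exact add_mem (neg_mem h1) h2

/-- The construction behind `K`: `δX` has vanishing source and target, hence is `r e`, and `r(δe) =
δδX = 0` makes `e` closed because `rmul` is injective on the core. -/
theorem exists_r2_eq_d1 {X : ∀ g, W (β g)} (hX : X ∈ 𝒱.sections) {σ : ∀ x, W₀ (β₀ x)}
    (hσ : 𝒱.IsLift X σ) : ∃ e ∈ 𝒱.kZ2, 𝒱.r2 e = 𝒱.d1 X := by
  have hσ1 : ∀ g, 𝒱.src g (X g) = σ (𝒢.src g) := fun g => (hσ g).1
  have hs := (R.isLift_iff_src_d1_eq_zero hσ1).1 hσ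
  obtain ⟨e, he, hr⟩ := R.exists_r2_eq
    ⟨R.d1_mem_smoothSectionsOn hX hσ1, 0, fun p => by
      rw [hs p, map_zero]; rfl⟩ hs (R.tgt_d1 hσ)
  have hk : ∀ p, e p ∈ 𝒱.kfib (𝒢.tgt p.1.1) := fun p => he.2 p trivial
  refine ⟨e, ⟨he, LinearMap.mem_ker.2 (funext fun p => ?_)⟩, hr⟩
  apply R.rmul_injOn (R.kd2_mem hk p).1
  rw [← R.d2_r2 hk, hr, R.d2_d1 hσ1]
  rfl

/-- The section of the side bundle onto which a projectable section projects. -/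
theorem exists_sideSection {X : ∀ g, W (β g)} (hX : X ∈ 𝒱.C1) :
    ∃ s : 𝒱.sideSections, ∀ g, 𝒱.src g (X g) = s.1 (𝒢.src g) := by
  obtain ⟨hX, σ, hσ⟩ := hX
  refine ⟨⟨σ, ?_⟩, hσ⟩
  -- Restriction to the units recovers the projection as `σ(x) = s(X(1_x))`, so it is smooth.
  refine (R.total.smooth_src.comp (ContMDiff.comp hX 𝒢.smooth_unit)).congr fun x => ?_
  change _ = R.total.src ⟨β (𝒢.unit x), X (𝒢.unit x)⟩
  rw [R.total_src, hσ, 𝒢.src_unit]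

theorem r1_injOn {e e' : ∀ g, W (β (𝒢.unit (𝒢.tgt g)))} (he : ∀ g, e g ∈ 𝒱.kfib (𝒢.tgt g))
    (he' : ∀ g, e' g ∈ 𝒱.kfib (𝒢.tgt g)) (h : 𝒱.r1 e = 𝒱.r1 e') : e = e' :=
  funext fun g => sub_eq_zero.1 (R.rmul_injOn (sub_mem (he g) (he' g)).1 (by
    rw [map_sub]; exact sub_eq_zero.2 (congrFun h g)))

theorem r2_injOn {e e' : ∀ p : 𝒢.Comp2, W (β (𝒢.unit (𝒢.tgt p.1.1)))}
    (he : ∀ p, e p ∈ 𝒱.kfib (𝒢.tgt p.1.1)) (he' : ∀ p, e' p ∈ 𝒱.kfib (𝒢.tgt p.1.1))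
    (h : 𝒱.r2 e = 𝒱.r2 e') : e = e' :=
  funext fun p => sub_eq_zero.1 (R.rmul_injOn (sub_mem (he p) (he' p)).1 (by
    rw [map_sub]; exact sub_eq_zero.2 (congrFun h p)))

theorem section_ext {s s' : ∀ x, W₀ (β₀ x)} (h : ∀ g, s (𝒢.src g) = s' (𝒢.src g)) : s = s' := by
  funext x
  have := h (𝒢.unit x)
  rwa [𝒢.src_unit] at this

end VBMaps.Realization

/-! ### The exact sequence of a realized structure -/

namespace VBMaps

variable (𝒱 : VBMaps 𝒢 K β F W K₀ β₀ F₀ W₀)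

theorem r1_add (e e' : ∀ g, W (β (𝒢.unit (𝒢.tgt g)))) : 𝒱.r1 (e + e') = 𝒱.r1 e + 𝒱.r1 e' :=
  funext fun _ => map_add _ _ _

theorem r1_smul (a : ℝ) (e : ∀ g, W (β (𝒢.unit (𝒢.tgt g)))) : 𝒱.r1 (a • e) = a • 𝒱.r1 e :=
  funext fun _ => map_smul _ _ _

theorem r2_add (e e' : ∀ p : 𝒢.Comp2, W (β (𝒢.unit (𝒢.tgt p.1.1)))) :
    𝒱.r2 (e + e') = 𝒱.r2 e + 𝒱.r2 e' :=
  funext fun _ => map_add _ _ _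

theorem r2_smul (a : ℝ) (e : ∀ p : 𝒢.Comp2, W (β (𝒢.unit (𝒢.tgt p.1.1)))) :
    𝒱.r2 (a • e) = a • 𝒱.r2 e :=
  funext fun _ => map_smul _ _ _

theorem kC0_le_C0 : 𝒱.kC0 ≤ 𝒱.C0 :=
  fun _ hα => ⟨hα.1, fun x _ => (hα.2 x trivial).1⟩

variable {𝒱}

theorem IsLift.add {X X' : ∀ g, W (β g)} {s s' : ∀ x, W₀ (β₀ x)} (h : 𝒱.IsLift X s)
    (h' : 𝒱.IsLift X' s') : 𝒱.IsLift (X + X') (s + s') := fun g =>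
  ⟨by simp [(h g).1, (h' g).1], by simp [(h g).2, (h' g).2]⟩

theorem IsLift.smul {X : ∀ g, W (β g)} {s : ∀ x, W₀ (β₀ x)} (a : ℝ) (h : 𝒱.IsLift X s) :
    𝒱.IsLift (a • X) (a • s) := fun g => ⟨by simp [(h g).1], by simp [(h g).2]⟩

theorem IsLift.sub {X X' : ∀ g, W (β g)} {s s' : ∀ x, W₀ (β₀ x)} (h : 𝒱.IsLift X s)
    (h' : 𝒱.IsLift X' s') : 𝒱.IsLift (X - X') (s - s') := fun g =>
  ⟨by simp [(h g).1, (h' g).1], by simp [(h g).2, (h' g).2]⟩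

theorem mk_mem_lInv {s : 𝒱.sideSections} {X : ∀ g, W (β g)} (hX : X ∈ 𝒱.sections)
    (h : 𝒱.IsLift X s.1) : (Submodule.Quotient.mk s : 𝒱.lSections) ∈ 𝒱.lInv :=
  ⟨s, ⟨X, hX, h⟩, rfl⟩

theorem exists_isLift (ℓ : 𝒱.lInv) : ∃ (s : 𝒱.sideSections) (X : 𝒱.sections),
    𝒱.IsLift X.1 s.1 ∧ (ℓ : 𝒱.lSections) = Submodule.Quotient.mk s := by
  obtain ⟨s, ⟨X, hX, h⟩, e⟩ := ℓ.2
  exact ⟨s, ⟨X, hX⟩, h, e.symm⟩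

namespace Realization

variable (R : 𝒱.Realization)

include R

theorem r1_isLift {e : ∀ g, W (β (𝒢.unit (𝒢.tgt g)))} (he : ∀ g, e g ∈ 𝒱.kfib (𝒢.tgt g)) :
    𝒱.IsLift (𝒱.r1 e) 0 := fun g => by
  have ht : 𝒱.tgt (𝒢.unit (𝒢.tgt g)) (e g) = 0 := (he g).2
  exact ⟨R.src_rmul (he g).1, by rw [r1, R.tgt_rmul (he g).1, ht, map_zero]; rfl⟩

theorem r1_mem_C1 {e : ∀ g, W (β (𝒢.unit (𝒢.tgt g)))} (he : e ∈ 𝒱.kC1) : 𝒱.r1 e ∈ 𝒱.C1 :=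
  ⟨R.r1_mem_sections he, 0, fun g => (R.r1_isLift (fun g => he.2 g trivial) g).1⟩

theorem r1_mem_Z1 (e : 𝒱.kZ1) : 𝒱.r1 e.1 ∈ 𝒱.Z1 := by
  refine ⟨R.r1_mem_C1 e.2.1, ?_⟩
  rw [SetLike.mem_coe, LinearMap.mem_ker, R.d1_r1 (fun g => e.2.1.2 g trivial),
    LinearMap.mem_ker.1 e.2.2]
  exact funext fun p => map_zero _

theorem r2_mem_Z2 (e : 𝒱.kZ2) : 𝒱.r2 e.1 ∈ 𝒱.Z2 := by
  refine ⟨R.r2_mem_C2 e.2.1, LinearMap.mem_ker.2 (funext fun p => ?_)⟩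
  rw [R.d2_r2 (fun p => e.2.1.2 p trivial), LinearMap.mem_ker.1 e.2.2]
  exact map_zero _

/-- A lift of zero comes from a `𝔨`-valued cochain. -/
theorem exists_r1_eq_of_isLift {X : ∀ g, W (β g)} (hX : X ∈ 𝒱.sections) (h : 𝒱.IsLift X 0) :
    ∃ e ∈ 𝒱.kC1, 𝒱.r1 e = X :=
  R.exists_r1_eq hX (fun g => (h g).1) fun g => (h g).2

theorem isLift_of_Z1 {c : ∀ g, W (β g)} (hc : c ∈ 𝒱.Z1) {s : ∀ x, W₀ (β₀ x)}
    (h : ∀ g, 𝒱.src g (c g) = s (𝒢.src g)) : 𝒱.IsLift c s :=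
  (R.isLift_iff_src_d1_eq_zero h).2 fun p => by rw [LinearMap.mem_ker.1 hc.2]; exact map_zero _

theorem mem_kZ1_of_r1 {e : ∀ g, W (β (𝒢.unit (𝒢.tgt g)))} (he : e ∈ 𝒱.kC1)
    (h : 𝒱.d1 (𝒱.r1 e) = 0) : e ∈ 𝒱.kZ1 := by
  have hk : ∀ g, e g ∈ 𝒱.kfib (𝒢.tgt g) := fun g => he.2 g trivial
  rw [R.d1_r1 hk] at h
  refine ⟨he, R.r2_injOn (R.kd1_mem hk) (fun p => zero_mem (𝒱.kfib (𝒢.tgt p.1.1))) ?_⟩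
  rw [h]
  exact (funext fun p => map_zero _).symm

theorem isLift_d0_of_mem {α : ∀ x, W (β (𝒢.unit x))} (hα : α ∈ 𝒱.C0) :
    𝒱.IsLift (𝒱.d0 α) (𝒱.anchor α) :=
  R.isLift_d0 fun x => hα.2 x trivial

/-- Each map is defined by the relation that holds between the classes of related representatives.
Well-definedness then reduces to single-valuedness at zero, and the resulting equivalences compute
the map on any choice of representatives and lifts. -/
theorem lowDegreeExactSequence : 𝒱.LowDegreeExactSequence := by
  obtain ⟨ρ₁, hρ₁⟩ := exists_linearMap_of_relation
    (fun (a : 𝒱.kH1) (b : 𝒱.H1) => ∃ (e : 𝒱.kZ1) (c : 𝒱.Z1), c.1 = 𝒱.r1 e.1 ∧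
      a = Submodule.Quotient.mk e ∧ b = Submodule.Quotient.mk c)
    (by
      rintro _ _ _ _ ⟨e, c, h, rfl, rfl⟩ ⟨e', c', h', rfl, rfl⟩
      exact ⟨e + e', c + c', by simp [h, h', r1_add], rfl, rfl⟩)
    (by
      rintro t _ _ ⟨e, c, h, rfl, rfl⟩
      exact ⟨t • e, t • c, by simp [h, r1_smul], rfl, rfl⟩)
    (by
      intro a
      obtain ⟨e, rfl⟩ := Submodule.Quotient.mk_surjective _ a
      exact ⟨_, e, ⟨_, R.r1_mem_Z1 e⟩, rfl, rfl, rfl⟩)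
    (by
      rintro _ ⟨e, c, h, h0, rfl⟩
      obtain ⟨α, hα, e0⟩ := (Submodule.Quotient.mk_eq_zero _).1 h0.symm
      -- If `e = δα` in `𝔨`, then `r e = -δα` in the VB-complex.
      refine (Submodule.Quotient.mk_eq_zero _).2 ⟨-α, neg_mem (𝒱.kC0_le_C0 hα), ?_⟩
      rw [map_neg]
      change - 𝒱.d0 α = c.1
      rw [h]
      change 𝒱.kd0 α = e.1 at e0
      rw [← e0]
      funext g
      rw [Pi.neg_apply, R.d0_eq_neg_r1 (fun x => hα.2 x trivial), neg_neg])
  obtain ⟨pr, hpr⟩ := exists_linearMap_of_relation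
    (fun (a : 𝒱.H1) (b : 𝒱.lInv) => ∃ (c : 𝒱.Z1) (s : 𝒱.sideSections),
      (∀ g, 𝒱.src g (c.1 g) = s.1 (𝒢.src g)) ∧
      a = Submodule.Quotient.mk c ∧ (b : 𝒱.lSections) = Submodule.Quotient.mk s)
    (by
      rintro _ _ _ _ ⟨e, c, h, rfl, h2⟩ ⟨e', c', h', rfl, h2'⟩
      exact ⟨e + e', c + c', fun g => by simp [h, h'], rfl, by simp [h2, h2']⟩)
    (by
      rintro t _ _ ⟨e, c, h, rfl, h2⟩
      exact ⟨t • e, t • c, fun g => by simp [h], rfl, by simp [h2]⟩)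
    (by
      intro a
      obtain ⟨c, rfl⟩ := Submodule.Quotient.mk_surjective _ a
      obtain ⟨s, hs⟩ := R.exists_sideSection c.2.1
      exact ⟨⟨_, mk_mem_lInv c.2.1.1 (R.isLift_of_Z1 c.2 hs)⟩, c, s, hs, rfl, rfl⟩)
    (by
      rintro b ⟨c, s, h, h0, hb⟩
      -- A coboundary `δα` projects to `∂α`, which is zero in `Γ(𝔩)`.
      obtain ⟨α, hα, e0⟩ := (Submodule.Quotient.mk_eq_zero _).1 h0.symm
      change 𝒱.d0 α = c.1 at e0
      rw [← e0] at h
      apply Subtype.ext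
      rw [hb]
      refine (Submodule.Quotient.mk_eq_zero _).2 ⟨α, hα, ?_⟩
      exact R.section_ext fun g => ((R.isLift_d0_of_mem hα g).1).symm.trans (h g))
  obtain ⟨κ, hκ⟩ := exists_linearMap_of_relation
    (fun (a : 𝒱.lInv) (b : 𝒱.kH2) => ∃ (s : 𝒱.sideSections) (X : 𝒱.sections) (e : 𝒱.kZ2),
      𝒱.IsLift X.1 s.1 ∧ 𝒱.r2 e.1 = 𝒱.d1 X.1 ∧
      (a : 𝒱.lSections) = Submodule.Quotient.mk s ∧ b = Submodule.Quotient.mk e)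
    (by
      rintro _ _ _ _ ⟨s, X, e, h, h1, h2, rfl⟩ ⟨s', X', e', h', h1', h2', rfl⟩
      exact ⟨s + s', X + X', e + e', h.add h', by simp [r2_add, h1, h1'], by simp [h2, h2'], rfl⟩)
    (by
      rintro t _ _ ⟨s, X, e, h, h1, h2, rfl⟩
      exact ⟨t • s, t • X, t • e, h.smul t, by simp [r2_smul, h1], by simp [h2], rfl⟩)
    (by
      intro ℓ
      obtain ⟨s, X, h, hs⟩ := exists_isLift ℓ
      obtain ⟨e, he, hr⟩ := R.exists_r2_eq_d1 X.2 h
      exact ⟨_, s, X, ⟨e, he⟩, h, hr, hs, rfl⟩)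
    (by
      rintro _ ⟨s, X, e, h, h1, h2, rfl⟩
      obtain ⟨α, hα, e0⟩ := (Submodule.Quotient.mk_eq_zero _).1 h2.symm
      change 𝒱.anchor α = s.1 at e0
      rw [← e0] at h
      -- If `s = ∂α`, then `X - δα` lifts zero, so it equals `r e'` and `r e = δX = δ(r e') =
      -- r(δe')`. This gives at once independence of the lift and of the representative `s`.
      have h' := h.sub (R.isLift_d0_of_mem hα)
      rw [sub_self] at h'
      obtain ⟨e', he', hr⟩ := R.exists_r1_eq_of_isLift (sub_mem X.2 (R.d0_mem_C1 hα).1) h'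
      have hk' : ∀ g, e' g ∈ 𝒱.kfib (𝒢.tgt g) := fun g => he'.2 g trivial
      refine (Submodule.Quotient.mk_eq_zero _).2 ⟨e', he', ?_⟩
      change 𝒱.kd1 e' = e.1
      apply R.r2_injOn (R.kd1_mem hk') fun p => e.2.1.2 p trivial
      rw [h1, ← R.d1_r1 hk', hr, map_sub, R.d1_d0 fun x => hα.2 x trivial, sub_zero])
  obtain ⟨ρ₂, hρ₂⟩ := exists_linearMap_of_relation
    (fun (a : 𝒱.kH2) (b : 𝒱.H2) => ∃ (e : 𝒱.kZ2) (c : 𝒱.Z2), c.1 = 𝒱.r2 e.1 ∧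
      a = Submodule.Quotient.mk e ∧ b = Submodule.Quotient.mk c)
    (by
      rintro _ _ _ _ ⟨e, c, h, rfl, rfl⟩ ⟨e', c', h', rfl, rfl⟩
      exact ⟨e + e', c + c', by simp [h, h', r2_add], rfl, rfl⟩)
    (by
      rintro t _ _ ⟨e, c, h, rfl, rfl⟩
      exact ⟨t • e, t • c, by simp [h, r2_smul], rfl, rfl⟩)
    (by
      intro a
      obtain ⟨e, rfl⟩ := Submodule.Quotient.mk_surjective _ a
      exact ⟨_, e, ⟨_, R.r2_mem_Z2 e⟩, rfl, rfl, rfl⟩)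
    (by
      rintro _ ⟨e, c, h, h0, rfl⟩
      obtain ⟨e', he', e0⟩ := (Submodule.Quotient.mk_eq_zero _).1 h0.symm
      refine (Submodule.Quotient.mk_eq_zero _).2 ⟨𝒱.r1 e', R.r1_mem_C1 he', ?_⟩
      change 𝒱.d1 (𝒱.r1 e') = c.1
      change 𝒱.kd1 e' = e.1 at e0
      rw [h, ← e0, R.d1_r1 fun g => he'.2 g trivial])
  have hρ₁' : ∀ (e : 𝒱.kZ1), ρ₁ (Submodule.Quotient.mk e) =
      Submodule.Quotient.mk ⟨𝒱.r1 e.1, R.r1_mem_Z1 e⟩ :=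
    fun e => (hρ₁ _ _).1 ⟨e, _, rfl, rfl, rfl⟩
  have hρ₂' : ∀ (e : 𝒱.kZ2), ρ₂ (Submodule.Quotient.mk e) =
      Submodule.Quotient.mk ⟨𝒱.r2 e.1, R.r2_mem_Z2 e⟩ :=
    fun e => (hρ₂ _ _).1 ⟨e, _, rfl, rfl, rfl⟩
  refine ⟨ρ₁, pr, κ, ρ₂, fun e => ⟨⟨_, R.r1_mem_Z1 e⟩, rfl, hρ₁' e⟩, ?_, ?_,
    fun e => ⟨⟨_, R.r2_mem_Z2 e⟩, rfl, hρ₂' e⟩, ?_, ?_, ?_, ?_⟩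
  · intro c
    obtain ⟨s, hs⟩ := R.exists_sideSection c.2.1
    have hb := (hpr (Submodule.Quotient.mk c) ⟨_, mk_mem_lInv c.2.1.1 (R.isLift_of_Z1 c.2 hs)⟩).1
      ⟨c, s, hs, rfl, rfl⟩
    exact ⟨s, hs, congrArg Subtype.val hb⟩
  · intro ℓ s X h hℓ
    obtain ⟨e, he, hr⟩ := R.exists_r2_eq_d1 X.2 h
    exact ⟨⟨e, he⟩, hr, (hκ _ _).1 ⟨s, X, ⟨e, he⟩, h, hr, hℓ, rfl⟩⟩
  · rw [injective_iff_map_eq_zero]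
    intro a ha
    obtain ⟨e, rfl⟩ := Submodule.Quotient.mk_surjective _ a
    rw [hρ₁'] at ha
    obtain ⟨α, hα, e0⟩ := (Submodule.Quotient.mk_eq_zero _).1 ha
    change 𝒱.d0 α = 𝒱.r1 e.1 at e0
    have hk : ∀ g, e.1 g ∈ 𝒱.kfib (𝒢.tgt g) := fun g => e.2.1.2 g trivial
    -- Now `δα = r e` lifts both `∂α` and `0`, so `∂α = 0` and `α` takes values in `𝔨`.
    have hl := R.isLift_d0_of_mem hα
    have hz : 𝒱.anchor α = 0 := R.section_ext fun g => by
      rw [← (hl g).1, e0, (R.r1_isLift hk g).1]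
    have hαk : α ∈ 𝒱.kC0 := by
      refine ⟨hα.1, fun x _ => ⟨hα.2 x trivial, ?_⟩⟩
      exact (fibCast_eq_zero (fun x => W₀ (β₀ x)) (𝒢.tgt_unit x)).1 (congrFun hz x)
    have hαk' : ∀ x, α x ∈ 𝒱.kfib x := fun x => hαk.2 x trivial
    refine (Submodule.Quotient.mk_eq_zero _).2 ⟨-α, neg_mem hαk, ?_⟩
    change 𝒱.kd0 (-α) = e.1
    rw [map_neg]
    apply R.r1_injOn (fun g => neg_mem (R.kd0_mem hαk' g)) hk
    rw [← e0]
    funext g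
    rw [R.d0_eq_neg_r1 hαk']
    exact map_neg _ _
  · intro a
    obtain ⟨c, rfl⟩ := Submodule.Quotient.mk_surjective _ a
    obtain ⟨s, hs⟩ := R.exists_sideSection c.2.1
    have hl := R.isLift_of_Z1 c.2 hs
    constructor
    · intro h
      have hb := (hpr (Submodule.Quotient.mk c) ⟨_, mk_mem_lInv c.2.1.1 hl⟩).1 ⟨c, s, hs, rfl, rfl⟩
      rw [h] at hb
      obtain ⟨α, hα, e0⟩ := (Submodule.Quotient.mk_eq_zero _).1 (congrArg Subtype.val hb).symm
      change 𝒱.anchor α = s.1 at e0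
      -- With the projection of `c` equal to `∂α`, the cohomologous cocycle `c - δα` lifts zero and
      -- hence comes from `𝔨`.
      have h' := hl.sub (R.isLift_d0_of_mem hα)
      rw [e0, sub_self] at h'
      obtain ⟨e, he, hr⟩ := R.exists_r1_eq_of_isLift (sub_mem c.2.1.1 (R.d0_mem_C1 hα).1) h'
      have hz : e ∈ 𝒱.kZ1 := R.mem_kZ1_of_r1 he (by
        rw [hr, map_sub, LinearMap.mem_ker.1 c.2.2, R.d1_d0 fun x => hα.2 x trivial, sub_zero])
      refine ⟨Submodule.Quotient.mk ⟨e, hz⟩, ?_⟩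
      rw [hρ₁', Submodule.Quotient.eq]
      refine ⟨-α, neg_mem hα, ?_⟩
      change 𝒱.d0 (-α) = 𝒱.r1 e - c.1
      rw [hr, map_neg]
      abel
    · rintro ⟨b, hb⟩
      obtain ⟨e, rfl⟩ := Submodule.Quotient.mk_surjective _ b
      rw [← hb, hρ₁']
      refine (hpr _ _).1 ⟨⟨𝒱.r1 e.1, R.r1_mem_Z1 e⟩, 0, fun g => ?_, rfl, rfl⟩
      exact (R.r1_isLift (fun g => e.2.1.2 g trivial) g).1
  · intro ℓ
    constructor
    · intro h
      obtain ⟨s, X, e, hl, hr, hs, h0⟩ := (hκ ℓ 0).2 h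
      obtain ⟨e', he', e0⟩ := (Submodule.Quotient.mk_eq_zero _).1 h0.symm
      change 𝒱.kd1 e' = e.1 at e0
      have hk' : ∀ g, e' g ∈ 𝒱.kfib (𝒢.tgt g) := fun g => he'.2 g trivial
      -- From `δX = r e` and `e = δe'`, the cochain `X - r e'` is closed and still lifts `s`,
      -- because `r e'` lifts zero.
      have hl' : 𝒱.IsLift (X.1 - 𝒱.r1 e') s.1 := by
        have := hl.sub (R.r1_isLift hk')
        rwa [sub_zero] at this
      have hz : X.1 - 𝒱.r1 e' ∈ 𝒱.Z1 := by
        refine ⟨⟨sub_mem X.2 (R.r1_mem_sections he'), s.1, fun g => (hl' g).1⟩, ?_⟩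
        rw [SetLike.mem_coe, LinearMap.mem_ker, map_sub, R.d1_r1 hk', e0, hr, sub_self]
      exact ⟨Submodule.Quotient.mk ⟨_, hz⟩, (hpr _ _).1 ⟨⟨_, hz⟩, s, fun g => (hl' g).1, rfl, hs⟩⟩
    · rintro ⟨b, hb⟩
      obtain ⟨c, s, hs, -, hℓ⟩ := (hpr b ℓ).2 hb
      have hl := R.isLift_of_Z1 c.2 hs
      refine (hκ _ _).1 ⟨s, ⟨c.1, c.2.1.1⟩, 0, hl, ?_, hℓ, rfl⟩
      rw [LinearMap.mem_ker.1 c.2.2]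
      exact funext fun p => map_zero _
  · intro a
    obtain ⟨e, rfl⟩ := Submodule.Quotient.mk_surjective _ a
    have hk : ∀ p, e.1 p ∈ 𝒱.kfib _ := fun p => e.2.1.2 p trivial
    rw [hρ₂']
    constructor
    · intro h
      obtain ⟨X, hX, e0⟩ := (Submodule.Quotient.mk_eq_zero _).1 h
      change 𝒱.d1 X = 𝒱.r2 e.1 at e0
      obtain ⟨s, hs⟩ := R.exists_sideSection hX
      -- Since `δX = r e` has source zero, the projectable cochain `X` is a lift of its own
      -- projection, and `K` sends that class to `[e]`.
      have hl : 𝒱.IsLift X s.1 := (R.isLift_iff_src_d1_eq_zero hs).2 fun p => by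
        rw [e0]; exact R.src_rmul (hk p).1
      exact ⟨⟨_, mk_mem_lInv hX.1 hl⟩, (hκ _ _).1 ⟨s, ⟨X, hX.1⟩, e, hl, e0.symm, rfl, rfl⟩⟩
    · rintro ⟨ℓ, hℓ⟩
      obtain ⟨s, X, e', hl, hr, -, h2⟩ := (hκ ℓ _).2 hℓ
      rw [← hρ₂', h2, hρ₂']
      exact (Submodule.Quotient.mk_eq_zero _).2
        ⟨X.1, ⟨X.2, s.1, fun g => (hl g).1⟩, hr.symm⟩

end Realization

end VBMaps

end

/-! ### Local lifts along a submersion -/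

section Submersion

variable
    {EG EM : Type*} [NormedAddCommGroup EG] [NormedSpace ℝ EG]
    [NormedAddCommGroup EM] [NormedSpace ℝ EM]
    {G M : Type*} [TopologicalSpace G] [ChartedSpace EG G]
    [TopologicalSpace M] [ChartedSpace EM M]

/-- A submersion `f` has a smooth local lifting map `L`: near a given point, `L (x, g)` lies over
`x`, and `L (f g, g) = g`. -/
theorem Manifold.IsSubmersion.exists_local_lift {f : G → M}
    (hf : IsSubmersion 𝓘(ℝ, EG) 𝓘(ℝ, EM) ∞ f) (g : G) :
    ∃ (L : M × G → G) (U : Set (M × G)) (V : Set G), IsOpen U ∧ IsOpen V ∧ (f g, g) ∈ U ∧ g ∈ V ∧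
      ContMDiffOn (𝓘(ℝ, EM).prod 𝓘(ℝ, EG)) 𝓘(ℝ, EG) ∞ L U ∧
      (∀ q ∈ U, f (L q) = q.1) ∧ ∀ g' ∈ V, L (f g', g') = g' := by
  have h := hf.isSubmersionAt g
  set φ := h.domChart.extend 𝓘(ℝ, EG) with hφ
  set ψ := h.codChart.extend 𝓘(ℝ, EM) with hψ
  have sφ : φ.source = h.domChart.source := h.domChart.extend_source
  have sψ : ψ.source = h.codChart.source := h.codChart.extend_source
  have key : ∀ y ∈ φ.target, ψ (f (φ.symm y)) = (h.equiv y).1 := h.writtenInCharts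
  have hmaps : ∀ g' ∈ φ.source, f g' ∈ ψ.source := by
    rw [sφ, sψ]; exact h.source_subset_preimage_source
  have cφ : ContMDiffOn 𝓘(ℝ, EG) 𝓘(ℝ, EG) ∞ φ φ.source := by
    rw [sφ]; exact OpenPartialHomeomorph.contMDiffOn_extend h.domChart_mem_maximalAtlas
  have cψ : ContMDiffOn 𝓘(ℝ, EM) 𝓘(ℝ, EM) ∞ ψ ψ.source := by
    rw [sψ]; exact OpenPartialHomeomorph.contMDiffOn_extend h.codChart_mem_maximalAtlas
  have tφ : φ.target = h.domChart.target := by simp [hφ, OpenPartialHomeomorph.extend]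
  have oφt : IsOpen φ.target := by rw [tφ]; exact h.domChart.open_target
  have oφ : IsOpen φ.source := by rw [sφ]; exact h.domChart.open_source
  have oψ : IsOpen ψ.source := by rw [sψ]; exact h.codChart.open_source
  have cφs : ContMDiffOn 𝓘(ℝ, EG) 𝓘(ℝ, EG) ∞ φ.symm φ.target := by
    have := contMDiffOn_extend_symm h.domChart_mem_maximalAtlas
    rwa [show (𝓘(ℝ, EG) : EG → EG) '' h.domChart.target = φ.target by simp [tφ]] at this
  -- In adapted charts `f` is the projection of `EM × complement`. The lift takes its first
  -- coordinate from the prescribed base point and its complementary coordinate from `g`.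
  let Y : M × G → EG := fun q => h.equiv.symm (ψ q.1, (h.equiv (φ q.2)).2)
  have cY : ContMDiffOn (𝓘(ℝ, EM).prod 𝓘(ℝ, EG)) 𝓘(ℝ, EG) ∞ Y (ψ.source ×ˢ φ.source) := by
    have a1 : ContMDiffOn (𝓘(ℝ, EM).prod 𝓘(ℝ, EG)) 𝓘(ℝ, EM) ∞ (fun q : M × G => ψ q.1)
        (ψ.source ×ˢ φ.source) := cψ.comp contMDiffOn_fst fun q hq => hq.1
    have a2 : ContMDiffOn (𝓘(ℝ, EM).prod 𝓘(ℝ, EG)) 𝓘(ℝ, EG) ∞ (fun q : M × G => φ q.2)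
        (ψ.source ×ˢ φ.source) := cφ.comp contMDiffOn_snd fun q hq => hq.2
    have a3 := (((ContinuousLinearMap.snd ℝ EM h.complement).comp
      (h.equiv : EG →L[ℝ] EM × h.complement)).contMDiff (n := ∞)).comp_contMDiffOn a2
    exact (h.equiv.symm : EM × h.complement →L[ℝ] EG).contMDiff.comp_contMDiffOn
      (a1.prodMk_space a3)
  have Yf : ∀ g' ∈ φ.source, Y (f g', g') = φ g' := by
    intro g' hg'
    have e := key (φ g') (φ.map_source hg')
    rw [φ.left_inv hg'] at e
    change h.equiv.symm (ψ (f g'), (h.equiv (φ g')).2) = φ g'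
    rw [e, Prod.mk.eta, ContinuousLinearEquiv.symm_apply_apply]
  have hg : g ∈ φ.source := by rw [sφ]; exact h.mem_domChart_source
  refine ⟨fun q => φ.symm (Y q), (ψ.source ×ˢ φ.source) ∩ Y ⁻¹' φ.target, φ.source,
    cY.continuousOn.isOpen_inter_preimage (oψ.prod oφ) oφt, oφ, ⟨⟨hmaps g hg, hg⟩, ?_⟩, hg,
    cφs.comp (cY.mono Set.inter_subset_left) fun q hq => hq.2, ?_, ?_⟩
  · rw [Set.mem_preimage, Yf g hg]
    exact φ.map_source hg
  · rintro q ⟨⟨h1, h2⟩, h3⟩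
    apply ψ.injOn (hmaps _ (φ.map_target h3)) h1
    rw [key _ h3]
    simp [Y]
  · intro g' hg'
    change φ.symm (Y (f g', g')) = g'
    rw [Yf g' hg', φ.left_inv hg']

end Submersion

/-! ### Tangent vectors as velocities of curves -/

section Velocity

variable
    {EP HP EG HG EM HM : Type*} [NormedAddCommGroup EP] [NormedSpace ℝ EP] [TopologicalSpace HP]
    [NormedAddCommGroup EG] [NormedSpace ℝ EG] [TopologicalSpace HG]
    [NormedAddCommGroup EM] [NormedSpace ℝ EM] [TopologicalSpace HM]
    {IP : ModelWithCorners ℝ EP HP}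
    {I : ModelWithCorners ℝ EG HG} {J : ModelWithCorners ℝ EM HM}
    {P G M : Type*} [TopologicalSpace P] [ChartedSpace HP P]
    [TopologicalSpace G] [ChartedSpace HG G]
    [TopologicalSpace M] [ChartedSpace HM M]

theorem tangentMap_prodMk {f : P → G} {f' : P → M} {x : TangentBundle IP P}
    (hf : MDifferentiableAt IP I f x.1) (hf' : MDifferentiableAt IP J f' x.1) :
    tangentMap IP (I.prod J) (fun p => (f p, f' p)) x =
      (equivTangentBundleProd I G J M).symm (tangentMap IP I f x, tangentMap IP J f' x) := by
  simp only [tangentMap, mfderiv_prodMk hf hf']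
  rfl

theorem tangentMap_congr {f f' : P → G} {x : TangentBundle IP P} (h : f =ᶠ[nhds x.1] f') :
    tangentMap IP I f x = tangentMap IP I f' x := by
  refine TotalSpace.ext h.self_of_nhds ?_
  simp only [tangentMap]
  rw [h.mfderiv_eq]
  exact HEq.rfl

/-- The velocity of a curve at time `0`. -/
noncomputable def velocity (I : ModelWithCorners ℝ EG HG) (γ : ℝ → G) : TangentBundle I G :=
  tangentMap 𝓘(ℝ, ℝ) I γ ⟨0, (1 : ℝ)⟩

theorem mdifferentiableAt_comp_curve {γ : ℝ → G} {f : G → M}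
    (hf : MDifferentiableAt I J f (γ 0)) (hγ : MDifferentiableAt 𝓘(ℝ, ℝ) I γ 0) :
    MDifferentiableAt 𝓘(ℝ, ℝ) J (fun t => f (γ t)) 0 :=
  hf.comp 0 hγ

theorem velocity_comp {γ : ℝ → G} {f : G → M} (hf : MDifferentiableAt I J f (γ 0))
    (hγ : MDifferentiableAt 𝓘(ℝ, ℝ) I γ 0) :
    tangentMap I J f (velocity I γ) = velocity J (fun t => f (γ t)) :=
  (tangentMap_comp_at (f := γ) (⟨0, (1 : ℝ)⟩ : TangentBundle 𝓘(ℝ, ℝ) ℝ) hf hγ).symm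

theorem velocity_congr {γ γ' : ℝ → G} (h : γ =ᶠ[nhds 0] γ') : velocity I γ = velocity I γ' :=
  tangentMap_congr h

/-- The curve is a straight line in the chart at the base point. Absence of boundary keeps the line
inside the model range and makes the inverse chart differentiable at its starting point. -/
theorem exists_velocity_eq [I.Boundaryless] [IsManifold I 1 G] (x : TangentBundle I G) :
    ∃ γ : ℝ → G, MDifferentiableAt 𝓘(ℝ, ℝ) I γ 0 ∧ velocity I γ = x := by
  obtain ⟨g, v⟩ := x
  have hinv := isInvertible_mfderivWithin_extChartAt_symm (I := I) (mem_extChartAt_target (I := I) g)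
  have hd := mdifferentiableWithinAt_extChartAt_symm (I := I) (mem_extChartAt_target (I := I) g)
  rw [I.range_eq_univ, mdifferentiableWithinAt_univ] at hd
  rw [I.range_eq_univ, mfderivWithin_univ] at hinv
  have hg : (extChartAt I g).symm (extChartAt I g g) = g := extChartAt_to_inv g
  -- `w` is `v` read in the fibre over the propositionally equal point `(extChartAt I g).symm
  -- (extChartAt I g g)`.
  obtain ⟨w, hw⟩ : ∃ w : TangentSpace I ((extChartAt I g).symm (extChartAt I g g)),
      (⟨_, w⟩ : TangentBundle I G) = ⟨g, v⟩ := by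
    rw [hg]; exact ⟨v, rfl⟩
  obtain ⟨u, hu⟩ : ∃ u : EG, mfderiv 𝓘(ℝ, EG) I (extChartAt I g).symm (extChartAt I g g) u = w := by
    obtain ⟨A, hA⟩ := hinv
    exact ⟨A.symm w, by rw [← hA]; exact A.apply_symm_apply w⟩
  let c : ℝ → EG := fun t => extChartAt I g g + t • u
  have c0 : c 0 = extChartAt I g g := by simp [c]
  have hc : HasDerivAt c u 0 := by
    simpa [c] using ((hasDerivAt_id (0 : ℝ)).smul_const u).const_add (extChartAt I g g)
  have hc' := hc.hasFDerivAt.hasMFDerivAt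
  have hd' : MDifferentiableAt 𝓘(ℝ, EG) I (extChartAt I g).symm (c 0) := by rwa [c0]
  have hv : velocity 𝓘(ℝ, EG) c = ⟨extChartAt I g g, u⟩ := by
    refine TotalSpace.ext c0 (heq_of_eq ?_)
    change mfderiv 𝓘(ℝ, ℝ) 𝓘(ℝ, EG) c 0 (1 : ℝ) = u
    rw [hc'.mfderiv]
    exact one_smul ℝ u
  refine ⟨fun t => (extChartAt I g).symm (c t), hd'.comp _ hc'.mdifferentiableAt, ?_⟩
  rw [← velocity_comp (I := 𝓘(ℝ, EG)) hd' hc'.mdifferentiableAt, hv, ← hw, ← hu]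
  rfl

end Velocity

/-! ### The tangent groupoid -/

namespace LieGroupoid

variable
    {EG EM : Type*} [NormedAddCommGroup EG] [NormedSpace ℝ EG]
    [NormedAddCommGroup EM] [NormedSpace ℝ EM]
    {G M : Type*} [TopologicalSpace G] [ChartedSpace EG G] [IsManifold 𝓘(ℝ, EG) ∞ G]
    [TopologicalSpace M] [ChartedSpace EM M] [IsManifold 𝓘(ℝ, EM) ∞ M]
    (𝒢 : LieGroupoid 𝓘(ℝ, EG) 𝓘(ℝ, EM) G M)

theorem mdifferentiable_src : MDifferentiable 𝓘(ℝ, EG) 𝓘(ℝ, EM) 𝒢.src :=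
  𝒢.smooth_src.mdifferentiable (by simp)

theorem mdifferentiable_tgt : MDifferentiable 𝓘(ℝ, EG) 𝓘(ℝ, EM) 𝒢.tgt :=
  𝒢.smooth_tgt.mdifferentiable (by simp)

theorem mdifferentiable_unit : MDifferentiable 𝓘(ℝ, EM) 𝓘(ℝ, EG) 𝒢.unit :=
  𝒢.smooth_unit.mdifferentiable (by simp)

theorem mdifferentiable_inv : MDifferentiable 𝓘(ℝ, EG) 𝓘(ℝ, EG) 𝒢.inv :=
  𝒢.smooth_inv.mdifferentiable (by simp)

/-- A tangent vector composable with the velocity of a curve is the velocity of a curve composable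
with the given one. -/
theorem exists_composable_curve {γ : ℝ → G} (hγ : MDifferentiableAt 𝓘(ℝ, ℝ) 𝓘(ℝ, EG) γ 0)
    {x : TangentBundle 𝓘(ℝ, EG) G}
    (hx : tangentMap 𝓘(ℝ, EG) 𝓘(ℝ, EM) 𝒢.src x =
      tangentMap 𝓘(ℝ, EG) 𝓘(ℝ, EM) 𝒢.tgt (velocity 𝓘(ℝ, EG) γ)) :
    ∃ γ' : ℝ → G, MDifferentiableAt 𝓘(ℝ, ℝ) 𝓘(ℝ, EG) γ' 0 ∧ velocity 𝓘(ℝ, EG) γ' = x ∧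
      ∀ᶠ t in nhds 0, 𝒢.src (γ' t) = 𝒢.tgt (γ t) := by
  obtain ⟨δ, hδ, rfl⟩ := exists_velocity_eq x
  obtain ⟨L, U, V, hU, hV, hgU, hgV, hL, hs, hid⟩ := 𝒢.submersion_src.exists_local_lift (δ 0)
  have h0 : 𝒢.src (δ 0) = 𝒢.tgt (γ 0) := congrArg TotalSpace.proj hx
  -- Any curve `δ` with velocity `x` is corrected to `L(t(γ), δ)`, whose source is `t(γ)`.
  let c : ℝ → M × G := fun t => (𝒢.tgt (γ t), δ t)
  have c0 : c 0 = (𝒢.src (δ 0), δ 0) := by simp [c, h0]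
  have ht : MDifferentiableAt 𝓘(ℝ, ℝ) 𝓘(ℝ, EM) (fun t => 𝒢.tgt (γ t)) 0 :=
    (𝒢.mdifferentiable_tgt _).comp _ hγ
  have hc : MDifferentiableAt 𝓘(ℝ, ℝ) (𝓘(ℝ, EM).prod 𝓘(ℝ, EG)) c 0 := ht.prodMk hδ
  have hLd : MDifferentiableAt (𝓘(ℝ, EM).prod 𝓘(ℝ, EG)) 𝓘(ℝ, EG) L (𝒢.src (δ 0), δ 0) :=
    (hL.contMDiffAt (hU.mem_nhds hgU)).mdifferentiableAt (by simp)
  have hLd' : MDifferentiableAt (𝓘(ℝ, EM).prod 𝓘(ℝ, EG)) 𝓘(ℝ, EG) L (c 0) := by rwa [c0]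
  refine ⟨fun t => L (c t), hLd'.comp _ hc, ?_, ?_⟩
  · rw [← velocity_comp hLd' hc]
    -- The correction preserves the velocity: by `hx`, `c` and `(s(δ), δ)` agree to first order at
    -- `0`, and `L(s(g), g) = g` near `δ 0`.
    have e1 : velocity (𝓘(ℝ, EM).prod 𝓘(ℝ, EG)) c =
        tangentMap 𝓘(ℝ, EG) (𝓘(ℝ, EM).prod 𝓘(ℝ, EG)) (fun g => (𝒢.src g, g))
          (velocity 𝓘(ℝ, EG) δ) := by
      have e2 := tangentMap_prodMk (I := 𝓘(ℝ, EM)) (J := 𝓘(ℝ, EG)) (f := 𝒢.src) (f' := id)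
        (x := velocity 𝓘(ℝ, EG) δ) (𝒢.mdifferentiable_src _) mdifferentiableAt_id
      refine (tangentMap_prodMk ht hδ).trans (Eq.trans ?_ e2.symm)
      rw [tangentMap_id, hx, velocity_comp (𝒢.mdifferentiable_tgt _) hγ]
      rfl
    rw [e1, ← tangentMap_comp_at]
    · rw [tangentMap_congr (f' := id), tangentMap_id, id]
      filter_upwards [hV.mem_nhds hgV] with g hg using hid g hg
    · exact hLd
    · exact (𝒢.mdifferentiable_src _).prodMk mdifferentiableAt_id
  · filter_upwards [hc.continuousAt.preimage_mem_nhds (hU.mem_nhds (by rwa [c0]))] with t ht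
    exact hs _ ht

/-- The multiplication of the tangent groupoid. -/
noncomputable def tangentMul (x y : TangentBundle 𝓘(ℝ, EG) G) : TangentBundle 𝓘(ℝ, EG) G :=
  ⟨𝒢.mul x.1 y.1, mfderivWithin (𝓘(ℝ, EG).prod 𝓘(ℝ, EG)) 𝓘(ℝ, EG)
    (fun p : G × G => 𝒢.mul p.1 p.2) 𝒢.Comp2 (x.1, y.1) (x.2, y.2)⟩

/-- `mfderivWithin` serves here merely as some derivative of `mul` within `G⁽²⁾`; its uniqueness is
not needed. The chain rule along composable curves determines its values on composable vectors. -/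
theorem hasMFDerivAt_mul_curves {γ γ' : ℝ → G} (hγ : MDifferentiableAt 𝓘(ℝ, ℝ) 𝓘(ℝ, EG) γ 0)
    (hγ' : MDifferentiableAt 𝓘(ℝ, ℝ) 𝓘(ℝ, EG) γ' 0)
    (hc : ∀ᶠ t in nhds 0, 𝒢.src (γ t) = 𝒢.tgt (γ' t)) :
    HasMFDerivAt 𝓘(ℝ, ℝ) 𝓘(ℝ, EG) (fun t => 𝒢.mul (γ t) (γ' t)) 0
      ((mfderivWithin (𝓘(ℝ, EG).prod 𝓘(ℝ, EG)) 𝓘(ℝ, EG)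
        (fun p : G × G => 𝒢.mul p.1 p.2) 𝒢.Comp2 (γ 0, γ' 0)).comp
        ((mfderiv 𝓘(ℝ, ℝ) 𝓘(ℝ, EG) γ 0).prod (mfderiv 𝓘(ℝ, ℝ) 𝓘(ℝ, EG) γ' 0))) := by
  have h1 := hγ.hasMFDerivAt.prodMk hγ'.hasMFDerivAt
  have h2 : HasMFDerivWithinAt (𝓘(ℝ, EG).prod 𝓘(ℝ, EG)) 𝓘(ℝ, EG)
      (fun p : G × G => 𝒢.mul p.1 p.2) 𝒢.Comp2 (γ 0, γ' 0) _ :=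
    ((𝒢.smooth_mul (γ 0, γ' 0) hc.self_of_nhds).mdifferentiableWithinAt
      (by simp)).hasMFDerivWithinAt
  have hsub : {t | 𝒢.src (γ t) = 𝒢.tgt (γ' t)} ⊆ (fun t => (γ t, γ' t)) ⁻¹' 𝒢.Comp2 :=
    fun t ht => ht
  exact (h2.comp (0 : ℝ) h1.hasMFDerivWithinAt hsub).hasMFDerivAt hc

theorem mdifferentiableAt_mul_curves {γ γ' : ℝ → G}
    (hγ : MDifferentiableAt 𝓘(ℝ, ℝ) 𝓘(ℝ, EG) γ 0)
    (hγ' : MDifferentiableAt 𝓘(ℝ, ℝ) 𝓘(ℝ, EG) γ' 0)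
    (hc : ∀ᶠ t in nhds 0, 𝒢.src (γ t) = 𝒢.tgt (γ' t)) :
    MDifferentiableAt 𝓘(ℝ, ℝ) 𝓘(ℝ, EG) (fun t => 𝒢.mul (γ t) (γ' t)) 0 :=
  (𝒢.hasMFDerivAt_mul_curves hγ hγ' hc).mdifferentiableAt

theorem tangentMul_velocity {γ γ' : ℝ → G} (hγ : MDifferentiableAt 𝓘(ℝ, ℝ) 𝓘(ℝ, EG) γ 0)
    (hγ' : MDifferentiableAt 𝓘(ℝ, ℝ) 𝓘(ℝ, EG) γ' 0)
    (hc : ∀ᶠ t in nhds 0, 𝒢.src (γ t) = 𝒢.tgt (γ' t)) :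
    𝒢.tangentMul (velocity 𝓘(ℝ, EG) γ) (velocity 𝓘(ℝ, EG) γ') =
      velocity 𝓘(ℝ, EG) (fun t => 𝒢.mul (γ t) (γ' t)) := by
  have h := (𝒢.hasMFDerivAt_mul_curves hγ hγ' hc).mfderiv
  simp only [velocity, tangentMap, h]
  rfl

theorem exists_composable_curves {x y : TangentBundle 𝓘(ℝ, EG) G}
    (h : tangentMap 𝓘(ℝ, EG) 𝓘(ℝ, EM) 𝒢.src x = tangentMap 𝓘(ℝ, EG) 𝓘(ℝ, EM) 𝒢.tgt y) :
    ∃ γ γ' : ℝ → G, MDifferentiableAt 𝓘(ℝ, ℝ) 𝓘(ℝ, EG) γ 0 ∧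
      MDifferentiableAt 𝓘(ℝ, ℝ) 𝓘(ℝ, EG) γ' 0 ∧ velocity 𝓘(ℝ, EG) γ = x ∧
      velocity 𝓘(ℝ, EG) γ' = y ∧ ∀ᶠ t in nhds 0, 𝒢.src (γ t) = 𝒢.tgt (γ' t) := by
  obtain ⟨γ', hγ', rfl⟩ := exists_velocity_eq y
  obtain ⟨γ, hγ, rfl, hc⟩ := 𝒢.exists_composable_curve hγ' h
  exact ⟨γ, γ', hγ, hγ', rfl, rfl, hc⟩

/-- Near a composable pair, `m (g, h) = L(t(h), g) · h` extends `mul` smoothly to an open subset of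
`G × G`, so its tangent map is smooth. On composable vectors that map agrees with `tangentMul`, as
composable curves show: along them `L(t(γ'), γ) = L(s(γ), γ) = γ`. -/
theorem contMDiffOn_tangentMul :
    ContMDiffOn ((𝓘(ℝ, EG).prod 𝓘(ℝ, EG)).prod (𝓘(ℝ, EG).prod 𝓘(ℝ, EG)))
      (𝓘(ℝ, EG).prod 𝓘(ℝ, EG)) ∞
      (fun p : TangentBundle 𝓘(ℝ, EG) G × TangentBundle 𝓘(ℝ, EG) G => 𝒢.tangentMul p.1 p.2)
      {p | tangentMap 𝓘(ℝ, EG) 𝓘(ℝ, EM) 𝒢.src p.1 =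
        tangentMap 𝓘(ℝ, EG) 𝓘(ℝ, EM) 𝒢.tgt p.2} := by
  rintro ⟨x₀, y₀⟩ hxy₀
  obtain ⟨L, U, V, hU, hV, hgU, hgV, hL, hs, hid⟩ := 𝒢.submersion_src.exists_local_lift x₀.1
  have h0 : 𝒢.src x₀.1 = 𝒢.tgt y₀.1 := congrArg TotalSpace.proj hxy₀
  let m : G × G → G := fun p => 𝒢.mul (L (𝒢.tgt p.2, p.1)) p.2
  let U' : Set (G × G) := {p | (𝒢.tgt p.2, p.1) ∈ U}
  have hq : ContMDiff (𝓘(ℝ, EG).prod 𝓘(ℝ, EG)) (𝓘(ℝ, EM).prod 𝓘(ℝ, EG)) ∞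
      (fun p : G × G => (𝒢.tgt p.2, p.1)) :=
    (𝒢.smooth_tgt.comp contMDiff_snd).prodMk contMDiff_fst
  have hU' : IsOpen U' := hU.preimage hq.continuous
  have hm : ContMDiffOn (𝓘(ℝ, EG).prod 𝓘(ℝ, EG)) 𝓘(ℝ, EG) ∞ m U' :=
    𝒢.smooth_mul.comp ((hL.comp hq.contMDiffOn fun p hp => hp).prodMk contMDiffOn_snd)
      fun p hp => hs _ hp
  have hT := hm.contMDiffOn_tangentMapWithin (m := ∞) (by simp) hU'.uniqueMDiffOn
  have hT' := hT.comp (contMDiff_equivTangentBundleProd_symm (n := ∞)).contMDiffOn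
    (fun p hp => hp)
  have hmem : (x₀, y₀) ∈ (equivTangentBundleProd 𝓘(ℝ, EG) G 𝓘(ℝ, EG) G).symm ⁻¹'
      (TotalSpace.proj ⁻¹' U') := by
    change (𝒢.tgt y₀.1, x₀.1) ∈ U
    rwa [← h0]
  have key : ∀ p : TangentBundle 𝓘(ℝ, EG) G × TangentBundle 𝓘(ℝ, EG) G,
      tangentMap 𝓘(ℝ, EG) 𝓘(ℝ, EM) 𝒢.src p.1 = tangentMap 𝓘(ℝ, EG) 𝓘(ℝ, EM) 𝒢.tgt p.2 →
      p.1.1 ∈ V → (p.1.1, p.2.1) ∈ U' →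
      𝒢.tangentMul p.1 p.2 = tangentMapWithin (𝓘(ℝ, EG).prod 𝓘(ℝ, EG)) 𝓘(ℝ, EG) m U'
        ((equivTangentBundleProd 𝓘(ℝ, EG) G 𝓘(ℝ, EG) G).symm p) := by
    rintro ⟨x, y⟩ hxy hxV hU'p
    obtain ⟨γ, γ', hγ, hγ', rfl, rfl, hc⟩ := 𝒢.exists_composable_curves hxy
    have hmd : MDifferentiableAt (𝓘(ℝ, EG).prod 𝓘(ℝ, EG)) 𝓘(ℝ, EG) m (γ 0, γ' 0) :=
      (hm.contMDiffAt (hU'.mem_nhds hU'p)).mdifferentiableAt (by simp)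
    have e1 := tangentMap_prodMk (x := ⟨0, (1 : ℝ)⟩) hγ hγ'
    change _ = tangentMapWithin (𝓘(ℝ, EG).prod 𝓘(ℝ, EG)) 𝓘(ℝ, EG) m U'
      ((equivTangentBundleProd 𝓘(ℝ, EG) G 𝓘(ℝ, EG) G).symm
        (tangentMap 𝓘(ℝ, ℝ) 𝓘(ℝ, EG) γ ⟨0, (1 : ℝ)⟩, tangentMap 𝓘(ℝ, ℝ) 𝓘(ℝ, EG) γ' ⟨0, (1 : ℝ)⟩))
    rw [← e1, tangentMapWithin_eq_tangentMap (hU'.uniqueMDiffWithinAt hU'p) hmd]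
    change _ = tangentMap _ _ m (velocity _ fun t => (γ t, γ' t))
    rw [velocity_comp hmd (hγ.prodMk hγ'), 𝒢.tangentMul_velocity hγ hγ' hc]
    refine velocity_congr ?_
    filter_upwards [hc, hγ.continuousAt.preimage_mem_nhds (hV.mem_nhds hxV)] with t ht htV
    change _ = 𝒢.mul (L (𝒢.tgt (γ' t), γ t)) (γ' t)
    rw [← ht, hid _ htV]
  have hopen : IsOpen ((equivTangentBundleProd 𝓘(ℝ, EG) G 𝓘(ℝ, EG) G).symm ⁻¹'
      (TotalSpace.proj ⁻¹' U')) :=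
    (hU'.preimage (FiberBundle.continuous_proj _ _)).preimage
      (contMDiff_equivTangentBundleProd_symm (n := ∞)).continuous
  have hVopen : IsOpen {p : TangentBundle 𝓘(ℝ, EG) G × TangentBundle 𝓘(ℝ, EG) G | p.1.1 ∈ V} :=
    hV.preimage ((FiberBundle.continuous_proj EG _).comp continuous_fst)
  have hat := (hT'.contMDiffAt (hopen.mem_nhds hmem)).contMDiffWithinAt
    (s := {p | tangentMap 𝓘(ℝ, EG) 𝓘(ℝ, EM) 𝒢.src p.1 =
        tangentMap 𝓘(ℝ, EG) 𝓘(ℝ, EM) 𝒢.tgt p.2})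
  refine hat.congr_of_eventuallyEq ?_ (key _ hxy₀ hgV hmem)
  filter_upwards [self_mem_nhdsWithin, mem_nhdsWithin_of_mem_nhds (hopen.mem_nhds hmem),
    mem_nhdsWithin_of_mem_nhds (hVopen.mem_nhds hgV)] with p h1 h2 h3
  exact key p h1 h3 h2

theorem tangentMap_comp_eq {EP EQ ER : Type*} [NormedAddCommGroup EP] [NormedSpace ℝ EP]
    [NormedAddCommGroup EQ] [NormedSpace ℝ EQ] [NormedAddCommGroup ER] [NormedSpace ℝ ER]
    {P Q R : Type*} [TopologicalSpace P] [ChartedSpace EP P] [TopologicalSpace Q]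
    [ChartedSpace EQ Q] [TopologicalSpace R] [ChartedSpace ER R] {f : P → Q} {g : Q → R} {k : P → R}
    (hg : MDifferentiable 𝓘(ℝ, EQ) 𝓘(ℝ, ER) g) (hf : MDifferentiable 𝓘(ℝ, EP) 𝓘(ℝ, EQ) f)
    (h : ∀ p, g (f p) = k p) (x : TangentBundle 𝓘(ℝ, EP) P) :
    tangentMap 𝓘(ℝ, EQ) 𝓘(ℝ, ER) g (tangentMap 𝓘(ℝ, EP) 𝓘(ℝ, EQ) f x) =
      tangentMap 𝓘(ℝ, EP) 𝓘(ℝ, ER) k x := by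
  rw [← tangentMap_comp_at _ (hg _) (hf _), show g ∘ f = k from funext h]

/-- The tangent groupoid `TG ⇉ TM` of a Lie groupoid. -/
noncomputable def tangent : SmoothGroupoid (𝓘(ℝ, EG).prod 𝓘(ℝ, EG)) (𝓘(ℝ, EM).prod 𝓘(ℝ, EM))
    (TangentBundle 𝓘(ℝ, EG) G) (TangentBundle 𝓘(ℝ, EM) M) where
  src := tangentMap 𝓘(ℝ, EG) 𝓘(ℝ, EM) 𝒢.src
  tgt := tangentMap 𝓘(ℝ, EG) 𝓘(ℝ, EM) 𝒢.tgt
  unit := tangentMap 𝓘(ℝ, EM) 𝓘(ℝ, EG) 𝒢.unit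
  inv := tangentMap 𝓘(ℝ, EG) 𝓘(ℝ, EG) 𝒢.inv
  mul := 𝒢.tangentMul
  src_unit x := by
    rw [tangentMap_comp_eq 𝒢.mdifferentiable_src 𝒢.mdifferentiable_unit (k := id) 𝒢.src_unit,
      tangentMap_id, id]
  tgt_unit x := by
    rw [tangentMap_comp_eq 𝒢.mdifferentiable_tgt 𝒢.mdifferentiable_unit (k := id) 𝒢.tgt_unit,
      tangentMap_id, id]
  src_inv := tangentMap_comp_eq 𝒢.mdifferentiable_src 𝒢.mdifferentiable_inv 𝒢.src_inv
  tgt_inv := tangentMap_comp_eq 𝒢.mdifferentiable_tgt 𝒢.mdifferentiable_inv 𝒢.tgt_inv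
  -- Every law involving a product is the velocity at `0` of the same law in `G`, applied along
  -- composable curves.
  src_mul x y h := by
    obtain ⟨γ, γ', hγ, hγ', rfl, rfl, hc⟩ := 𝒢.exists_composable_curves h
    rw [𝒢.tangentMul_velocity hγ hγ' hc, velocity_comp (𝒢.mdifferentiable_src _) hγ',
      velocity_comp (𝒢.mdifferentiable_src _) (𝒢.mdifferentiableAt_mul_curves hγ hγ' hc)]
    refine velocity_congr ?_
    filter_upwards [hc] with t ht using 𝒢.src_mul _ _ ht
  tgt_mul x y h := by
    obtain ⟨γ, γ', hγ, hγ', rfl, rfl, hc⟩ := 𝒢.exists_composable_curves h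
    rw [𝒢.tangentMul_velocity hγ hγ' hc, velocity_comp (𝒢.mdifferentiable_tgt _) hγ,
      velocity_comp (𝒢.mdifferentiable_tgt _) (𝒢.mdifferentiableAt_mul_curves hγ hγ' hc)]
    refine velocity_congr ?_
    filter_upwards [hc] with t ht using 𝒢.tgt_mul _ _ ht
  mul_assoc x y z h h' := by
    -- The curves are chosen from right to left: a curve through `x` can be fitted to the already
    -- chosen `γ'`, so one triple serves both composabilities.
    obtain ⟨γ', γ'', hγ', hγ'', rfl, rfl, hc'⟩ := 𝒢.exists_composable_curves h'
    obtain ⟨γ, hγ, rfl, hc⟩ := 𝒢.exists_composable_curve hγ' h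
    have hc1 : ∀ᶠ t in nhds 0, 𝒢.src (𝒢.mul (γ t) (γ' t)) = 𝒢.tgt (γ'' t) := by
      filter_upwards [hc, hc'] with t ht ht'
      rw [𝒢.src_mul _ _ ht, ht']
    have hc2 : ∀ᶠ t in nhds 0, 𝒢.src (γ t) = 𝒢.tgt (𝒢.mul (γ' t) (γ'' t)) := by
      filter_upwards [hc, hc'] with t ht ht'
      rw [𝒢.tgt_mul _ _ ht', ht]
    rw [𝒢.tangentMul_velocity hγ hγ' hc, 𝒢.tangentMul_velocity hγ' hγ'' hc',
      𝒢.tangentMul_velocity (𝒢.mdifferentiableAt_mul_curves hγ hγ' hc) hγ'' hc1,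
      𝒢.tangentMul_velocity hγ (𝒢.mdifferentiableAt_mul_curves hγ' hγ'' hc') hc2]
    refine velocity_congr ?_
    filter_upwards [hc, hc'] with t ht ht' using 𝒢.mul_assoc _ _ _ ht ht'
  unit_mul x := by
    obtain ⟨γ, hγ, rfl⟩ := exists_velocity_eq x
    have h1 := mdifferentiableAt_comp_curve (𝒢.mdifferentiable_tgt _) hγ
    have h2 := mdifferentiableAt_comp_curve (𝒢.mdifferentiable_unit _) h1
    rw [velocity_comp (𝒢.mdifferentiable_tgt _) hγ, velocity_comp (𝒢.mdifferentiable_unit _) h1,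
      𝒢.tangentMul_velocity h2 hγ (.of_forall fun t => 𝒢.src_unit _)]
    exact velocity_congr (.of_forall fun t => 𝒢.unit_mul _)
  mul_unit x := by
    obtain ⟨γ, hγ, rfl⟩ := exists_velocity_eq x
    have h1 := mdifferentiableAt_comp_curve (𝒢.mdifferentiable_src _) hγ
    have h2 := mdifferentiableAt_comp_curve (𝒢.mdifferentiable_unit _) h1
    rw [velocity_comp (𝒢.mdifferentiable_src _) hγ, velocity_comp (𝒢.mdifferentiable_unit _) h1,
      𝒢.tangentMul_velocity hγ h2 (.of_forall fun t => (𝒢.tgt_unit _).symm)]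
    exact velocity_congr (.of_forall fun t => 𝒢.mul_unit _)
  inv_mul x := by
    obtain ⟨γ, hγ, rfl⟩ := exists_velocity_eq x
    have h1 := mdifferentiableAt_comp_curve (𝒢.mdifferentiable_src _) hγ
    have h2 := mdifferentiableAt_comp_curve (𝒢.mdifferentiable_inv _) hγ
    rw [velocity_comp (𝒢.mdifferentiable_src _) hγ, velocity_comp (𝒢.mdifferentiable_unit _) h1,
      velocity_comp (𝒢.mdifferentiable_inv _) hγ,
      𝒢.tangentMul_velocity h2 hγ (.of_forall fun t => 𝒢.src_inv _)]
    exact velocity_congr (.of_forall fun t => 𝒢.inv_mul _)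
  mul_inv x := by
    obtain ⟨γ, hγ, rfl⟩ := exists_velocity_eq x
    have h1 := mdifferentiableAt_comp_curve (𝒢.mdifferentiable_tgt _) hγ
    have h2 := mdifferentiableAt_comp_curve (𝒢.mdifferentiable_inv _) hγ
    rw [velocity_comp (𝒢.mdifferentiable_tgt _) hγ, velocity_comp (𝒢.mdifferentiable_unit _) h1,
      velocity_comp (𝒢.mdifferentiable_inv _) hγ,
      𝒢.tangentMul_velocity hγ h2 (.of_forall fun t => (𝒢.tgt_inv _).symm)]
    exact velocity_congr (.of_forall fun t => 𝒢.mul_inv _)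
  smooth_src := 𝒢.smooth_src.contMDiff_tangentMap (by simp)
  smooth_unit := 𝒢.smooth_unit.contMDiff_tangentMap (by simp)
  smooth_inv := 𝒢.smooth_inv.contMDiff_tangentMap (by simp)
  smooth_mul := 𝒢.contMDiffOn_tangentMul

end LieGroupoid

/-! ### The two realizations and the theorem -/

/-- The pull-back of the tangent groupoid along a morphism is realized by the tangent groupoid. -/
noncomputable def LieGroupoid.Hom.pullbackTangentRealization
    {EG EM EH EN : Type*} [NormedAddCommGroup EG] [NormedSpace ℝ EG]
    [NormedAddCommGroup EM] [NormedSpace ℝ EM] [NormedAddCommGroup EH] [NormedSpace ℝ EH]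
    [NormedAddCommGroup EN] [NormedSpace ℝ EN]
    {G M H N : Type*} [TopologicalSpace G] [ChartedSpace EG G] [IsManifold 𝓘(ℝ, EG) ∞ G]
    [TopologicalSpace M] [ChartedSpace EM M] [IsManifold 𝓘(ℝ, EM) ∞ M]
    [TopologicalSpace H] [ChartedSpace EH H] [TopologicalSpace N] [ChartedSpace EN N]
    {𝒢 : LieGroupoid 𝓘(ℝ, EG) 𝓘(ℝ, EM) G M} {ℋ : LieGroupoid 𝓘(ℝ, EH) 𝓘(ℝ, EN) H N}
    (Φ : LieGroupoid.Hom ℋ 𝒢) : Φ.pullbackTangent.Realization where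
  total := 𝒢.tangent
  total_src h _ := (mk_fibCast EM (TangentSpace 𝓘(ℝ, EM) : M → Type _) id (Φ.map_src h) _).symm
  total_tgt h _ := (mk_fibCast EM (TangentSpace 𝓘(ℝ, EM) : M → Type _) id (Φ.map_tgt h) _).symm
  total_unit y _ :=
    (mk_fibCast EG (TangentSpace 𝓘(ℝ, EG) : G → Type _) id (Φ.map_unit y).symm _).symm
  total_inv h _ := (mk_fibCast EG (TangentSpace 𝓘(ℝ, EG) : G → Type _) id (Φ.map_inv h) _).symm
  total_mul h k hc _ _ _ :=
    (mk_fibCast EG (TangentSpace 𝓘(ℝ, EG) : G → Type _) id (Φ.map_mul h k hc).symm _).symm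

/-- A VB-groupoid is realized by its total groupoid. -/
noncomputable def VBGroupoid.realization
    {EG HG EM HM : Type*} [NormedAddCommGroup EG] [NormedSpace ℝ EG] [TopologicalSpace HG]
    [NormedAddCommGroup EM] [NormedSpace ℝ EM] [TopologicalSpace HM]
    {I : ModelWithCorners ℝ EG HG} {J : ModelWithCorners ℝ EM HM}
    {G M : Type*} [TopologicalSpace G] [ChartedSpace HG G]
    [TopologicalSpace M] [ChartedSpace HM M] {𝒢 : LieGroupoid I J G M}
    {FV : Type*} [NormedAddCommGroup FV] [NormedSpace ℝ FV]
    {V : G → Type*} [TopologicalSpace (TotalSpace FV V)] [∀ g, AddCommGroup (V g)]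
    [∀ g, Module ℝ (V g)] [∀ g, TopologicalSpace (V g)] [FiberBundle FV V] [VectorBundle ℝ FV V]
    [ContMDiffVectorBundle ∞ FV V I]
    {FE : Type*} [NormedAddCommGroup FE] [NormedSpace ℝ FE]
    {E : M → Type*} [TopologicalSpace (TotalSpace FE E)] [∀ x, AddCommGroup (E x)]
    [∀ x, Module ℝ (E x)] [∀ x, TopologicalSpace (E x)] [FiberBundle FE E] [VectorBundle ℝ FE E]
    [ContMDiffVectorBundle ∞ FE E J] (𝒱 : VBGroupoid 𝒢 FV V FE E) :
    𝒱.toVBMaps.Realization where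
  total := 𝒱.total.toSmoothGroupoid
  total_src := 𝒱.total_src
  total_tgt := 𝒱.total_tgt
  total_unit := 𝒱.total_unit
  total_inv := 𝒱.total_inv
  total_mul := 𝒱.total_mul

theorem mainTheorem7
    {EG EM : Type*}
    [NormedAddCommGroup EG] [NormedSpace ℝ EG] [FiniteDimensional ℝ EG]
    [NormedAddCommGroup EM] [NormedSpace ℝ EM] [FiniteDimensional ℝ EM]
    {G M : Type*}
    [TopologicalSpace G] [ChartedSpace EG G] [IsManifold 𝓘(ℝ, EG) ∞ G]
    [TopologicalSpace M] [ChartedSpace EM M] [IsManifold 𝓘(ℝ, EM) ∞ M]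
    (𝒢 : LieGroupoid 𝓘(ℝ, EG) 𝓘(ℝ, EM) G M) :
    -- the exact sequence of an arbitrary VB-groupoid over `𝒢`
    (∀ {FV FE : Type*}
      [NormedAddCommGroup FV] [NormedSpace ℝ FV] [FiniteDimensional ℝ FV]
      [NormedAddCommGroup FE] [NormedSpace ℝ FE] [FiniteDimensional ℝ FE]
      {V : G → Type*} [TopologicalSpace (TotalSpace FV V)] [∀ g, AddCommGroup (V g)]
      [∀ g, Module ℝ (V g)] [∀ g, TopologicalSpace (V g)] [FiberBundle FV V]
      [VectorBundle ℝ FV V] [ContMDiffVectorBundle ∞ FV V 𝓘(ℝ, EG)]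
      {E : M → Type*} [TopologicalSpace (TotalSpace FE E)] [∀ x, AddCommGroup (E x)]
      [∀ x, Module ℝ (E x)] [∀ x, TopologicalSpace (E x)] [FiberBundle FE E]
      [VectorBundle ℝ FE E] [ContMDiffVectorBundle ∞ FE E 𝓘(ℝ, EM)]
      (𝒱 : VBGroupoid 𝒢 FV V FE E),
      𝒱.toVBMaps.LowDegreeExactSequence) ∧
    -- the exact sequence of the deformation cohomology of a morphism `Φ : ℋ → 𝒢`
    (∀ {EH EN : Type*}
      [NormedAddCommGroup EH] [NormedSpace ℝ EH] [FiniteDimensional ℝ EH]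
      [NormedAddCommGroup EN] [NormedSpace ℝ EN] [FiniteDimensional ℝ EN]
      {H N : Type*}
      [TopologicalSpace H] [ChartedSpace EH H] [IsManifold 𝓘(ℝ, EH) ∞ H]
      [TopologicalSpace N] [ChartedSpace EN N] [IsManifold 𝓘(ℝ, EN) ∞ N]
      (ℋ : LieGroupoid 𝓘(ℝ, EH) 𝓘(ℝ, EN) H N) (Φ : LieGroupoid.Hom ℋ 𝒢),
      Φ.pullbackTangent.LowDegreeExactSequence) := by
  exact ⟨fun 𝒱 => 𝒱.realization.lowDegreeExactSequence,
    fun _ Φ => Φ.pullbackTangentRealization.lowDegreeExactSequence⟩
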